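/- All $C^*$-algebras are complex and not necessarily unital. An $A$-$B$-correspondence is a right Hilbert $B$-module $X$ together with a $*$-homomorphism $\phi_X$ from $A$ to the adjointable operators on $X$; $\otimes$ denotes the (completed) interior tensor product, $E^{\otimes m}$ the $m$-fold interior tensor power, and $\approx$ unitary equivalence of correspondences (a surjective inner-product preserving map commuting with the left and right actions). An $A$-$B$-imprimitivity bimodule is an $A$-$B$-correspondence $M$ with an additional $A$-valued left inner product ${}_A\langle\cdot,\cdot\rangle$ that is compatible with the left action and satisfies $\phi_M({}_A\langle\xi,\eta\rangle)\zeta=\xi\langle\eta,\zeta\rangle_B$, such that ${}_A\langle M,M\rangle$ and $\langle M,M\rangle_B$ span dense subspaces of $A$ and $B$. Let $E$ be a correspondence over $A$ and $F$ a correspondence over $B$, and let $\mathcal C$ be a class of correspondences. Then * $E$ and $F$ are strong Morita equivalent if $E\otimes_A M\approx M\otimes_B F$ for some $A$-$B$-imprimitivity bimodule $M$; * $E$ and $F$ are elementary strong shift equivalent in $\mathcal C$ if there are ${}_AR_B,\ {}_BS_A\in\mathcal C$ with $E\approx R\otimes_B S$ and $F\approx S\otimes_A R$; * $E$ and $F$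 are strong shift equivalent in $\mathcal C$ if there are $n\ge 0$ and correspondences $T_0,\dots,T_n\in\mathcal C$ (each over some $C^*$-algebra), with $T_0=E$ and $T_n=F$ up to unitary equivalence, such that $T_i$ and $T_{i+1}$ are elementary strong shift equivalent in $\mathcal C$ for $0\le i<n$; * $E$ and $F$ are shift equivalent in $\mathcal C$ if there are $m\ge 1$ and ${}_AR_B,\ {}_BS_A\in\mathcal C$ with $E^{\otimes m}\approx R\otimes_B S$, $F^{\otimes m}\approx S\otimes_A R$, $E\otimes_A R\approx R\otimes_B F$ and $S\otimes_A E\approx F\otimes_B S$. **Theorem.** Let $E$ be an $A$-$A$-imprimitivity bimodule and $F$ a $B$-$B$-imprimitivity bimodule. Then the following are equivalent: $E$ and $F$ are strong Morita equivalent; they are elementary strong shift equivalent; they are strong shift equivalent; they are shift equivalent. Here the last three relations may be taken either in the class of all correspondences or in the class of imprimitivity bimodules, and all seven resulting conditions are equivalent. In particular, the Shift Equivalence Problem has a positive answer for the class of imprimitivity bimodules. -/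

import Mathlib

open scoped TensorProduct
open UniformSpace

universe u

set_option linter.unusedSectionVars false

noncomputable section

namespace CorrShift

/-! ### Correspondences -/

section Definitions

variable (A B : Type u) [NonUnitalCStarAlgebra A] [PartialOrder A] [StarOrderedRing A]
  [NonUnitalCStarAlgebra B] [PartialOrder B] [StarOrderedRing B]

/-- An `A`-`B`-correspondence over (not necessarily unital) C⋆-algebras: a right Hilbert `B`-module
`X` (with `rmul b ξ = ξ b`, an inner product that is `B`-linear in the second variable, and which
is complete for the norm `‖ξ‖ = ‖⟨ξ, ξ⟩‖ ^ (1 / 2)`) with a ⋆-homomorphism `act = φ` from `A` to the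
adjointable operators on `X`. It may be degenerate, non-injective and non-full. -/
structure Correspondence where
  carrier : Type u
  [instGroup : NormedAddCommGroup carrier]
  [instSpace : NormedSpace ℂ carrier]
  [instComplete : CompleteSpace carrier]
  rmul : B →ₗ[ℂ] carrier →ₗ[ℂ] carrier
  inner : carrier →ₗ⋆[ℂ] carrier →ₗ[ℂ] B
  act : A →ₗ[ℂ] carrier →ₗ[ℂ] carrier
  rmul_mul : ∀ b c x, rmul (b * c) x = rmul c (rmul b x)
  inner_rmul : ∀ x y b, inner x (rmul b y) = inner x y * b
  star_inner : ∀ x y, star (inner x y) = inner y x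
  inner_self_nonneg : ∀ x, 0 ≤ inner x x
  norm_sq_eq : ∀ x, ‖x‖ ^ 2 = ‖inner x x‖
  act_mul : ∀ a b x, act (a * b) x = act a (act b x)
  inner_act : ∀ a x y, inner (act a x) y = inner x (act (star a) y)

attribute [instance] Correspondence.instGroup Correspondence.instSpace Correspondence.instComplete

instance : CoeSort (Correspondence A B) (Type u) := ⟨Correspondence.carrier⟩

/-- The algebraic data of a correspondence, with an inner product that is only positive
semidefinite; used to build tensor products by completion. -/
structure PreCorrespondence where
  carrier : Type u
  [instGroup : AddCommGroup carrier]
  [instModule : Module ℂ carrier]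
  rmul : B →ₗ[ℂ] carrier →ₗ[ℂ] carrier
  inner : carrier →ₗ⋆[ℂ] carrier →ₗ[ℂ] B
  act : A →ₗ[ℂ] carrier →ₗ[ℂ] carrier
  rmul_mul : ∀ b c x, rmul (b * c) x = rmul c (rmul b x)
  inner_rmul : ∀ x y b, inner x (rmul b y) = inner x y * b
  star_inner : ∀ x y, star (inner x y) = inner y x
  inner_self_nonneg : ∀ x, 0 ≤ inner x x
  act_mul : ∀ a b x, act (a * b) x = act a (act b x)
  inner_act : ∀ a x y, inner (act a x) y = inner x (act (star a) y)

attribute [instance] PreCorrespondence.instGroup PreCorrespondence.instModule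

end Definitions

section Cstar

variable {A B : Type u} [NonUnitalCStarAlgebra A] [PartialOrder A] [StarOrderedRing A]
  [NonUnitalCStarAlgebra B] [PartialOrder B] [StarOrderedRing B]

/-- A square root of `‖a‖ ^ 2 - a⋆ a` in the unitization, written without the unitization. -/
theorem exists_unitization_sqrt (a : A) : ∃ (l : ℂ) (d : A),
    star l * l = ((‖a‖ ^ 2 : ℝ) : ℂ) ∧
      star l • d + l • star d + star d * d = -(star a * a) := by
  have h := CStarAlgebra.star_mul_le_algebraMap_norm_sq (a := (a : Unitization ℂ A))
  rw [← sub_nonneg, CStarAlgebra.nonneg_iff_eq_star_mul_self, Unitization.norm_inr,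
    IsScalarTower.algebraMap_apply ℝ ℂ, Unitization.algebraMap_eq_inl] at h
  obtain ⟨c, hc⟩ := h
  rw [sub_eq_iff_eq_add] at hc
  refine ⟨c.fst, c.snd, ?_, ?_⟩
  · have := congrArg (fun z => z.fst) hc
    simpa using this.symm
  · have := congrArg (fun z => z.snd) hc
    rw [eq_neg_iff_add_eq_zero]
    simpa using this.symm

/-- The negative part of a self-adjoint element, with the properties used below. -/
theorem exists_negPart (M : A) (hM : IsSelfAdjoint M) :
    ∃ N : A, 0 ≤ N ∧ N * M * N = -(N * N * N) ∧ (N = 0 → 0 ≤ M) := by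
  refine ⟨M⁻, CFC.negPart_nonneg M, ?_, fun h => ?_⟩
  · have h := CFC.posPart_sub_negPart M hM
    calc M⁻ * M * M⁻ = M⁻ * (M⁺ - M⁻) * M⁻ := by rw [h]
      _ = _ := by rw [mul_sub, CFC.negPart_mul_posPart, zero_sub, neg_mul]
  · rw [← CFC.posPart_sub_negPart M hM, h, sub_zero]
    exact CFC.posPart_nonneg M

theorem exists_star_mul_self {a : A} (ha : 0 ≤ a) : ∃ s : A, a = star s * s :=
  CStarAlgebra.nonneg_iff_eq_star_mul_self.mp ha

end Cstar

/-! ### Completion of a pre-correspondence -/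

namespace PreCorrespondence

variable {A B : Type u} [NonUnitalCStarAlgebra A] [PartialOrder A] [StarOrderedRing A]
  [NonUnitalCStarAlgebra B] [PartialOrder B] [StarOrderedRing B]
  (P : PreCorrespondence A B)

theorem inner_rmul_left (x y : P.carrier) (b : B) :
    P.inner (P.rmul b x) y = star b * P.inner x y := by
  rw [← P.star_inner, P.inner_rmul, star_mul, P.star_inner]

theorem norm_inner_sq_le (x y : P.carrier) :
    ‖P.inner x y‖ ^ 2 ≤ ‖P.inner x x‖ * ‖P.inner y y‖ := by
  have key : ∀ t : ℝ, ‖P.inner x x‖ < t → ‖P.inner x y‖ ^ 2 ≤ t * ‖P.inner y y‖ := by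
    intro t ht
    have ht0 : 0 < t := lt_of_le_of_lt (norm_nonneg _) ht
    set b := P.inner x y with hb
    have hb' : P.inner y x = star b := by rw [hb, P.star_inner]
    have h0 := P.inner_self_nonneg (P.rmul b x - (t : ℂ) • y)
    have h1 : P.inner (P.rmul b x - (t : ℂ) • y) (P.rmul b x - (t : ℂ) • y)
        = star b * P.inner x x * b - (t : ℝ) • (star b * b) - (t : ℝ) • (star b * b)
          + (t * t : ℝ) • P.inner y y := by
      simp only [map_sub, LinearMap.sub_apply, map_smul, map_smulₛₗ, LinearMap.smul_apply,
        P.inner_rmul, inner_rmul_left, hb', ← hb, Complex.conj_ofReal]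
      simp only [Complex.coe_smul, mul_smul, mul_assoc, smul_sub]
      abel
    have h2 : star b * P.inner x x * b ≤ t • (star b * b) := by
      refine (CStarAlgebra.star_left_conjugate_le_norm_smul
        (hb := (P.inner_self_nonneg x).isSelfAdjoint)).trans ?_
      exact smul_le_smul_of_nonneg_right ht.le (star_mul_self_nonneg b)
    have h3 : t • (star b * b) ≤ (t * t : ℝ) • P.inner y y := by
      rw [h1] at h0
      have h4 := h0.trans (add_le_add_left (sub_le_sub_right (sub_le_sub_right h2 _) _) _)
      rw [sub_self, zero_sub, neg_add_eq_sub, sub_nonneg] at h4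
      exact h4
    have h5 := CStarAlgebra.norm_le_norm_of_nonneg_of_le
      (ha := smul_nonneg ht0.le (star_mul_self_nonneg b)) h3
    rw [norm_smul, norm_smul, CStarRing.norm_star_mul_self, Real.norm_of_nonneg ht0.le,
      Real.norm_of_nonneg (by positivity), mul_assoc, ← sq] at h5
    exact le_of_mul_le_mul_left h5 ht0
  have hlim : Filter.Tendsto (fun t : ℝ => t * ‖P.inner y y‖)
      (nhdsWithin ‖P.inner x x‖ (Set.Ioi ‖P.inner x x‖))
      (nhds (‖P.inner x x‖ * ‖P.inner y y‖)) :=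
    (Filter.tendsto_id.mul_const _).mono_left nhdsWithin_le_nhds
  exact ge_of_tendsto hlim (by filter_upwards [self_mem_nhdsWithin] with t ht using key t ht)

instance : Norm P.carrier := ⟨fun x => √‖P.inner x x‖⟩

theorem norm_def (x : P.carrier) : ‖x‖ = √‖P.inner x x‖ := rfl

theorem norm_sq_eq (x : P.carrier) : ‖x‖ ^ 2 = ‖P.inner x x‖ := by
  rw [norm_def, Real.sq_sqrt (norm_nonneg _)]

theorem norm_inner_le (x y : P.carrier) : ‖P.inner x y‖ ≤ ‖x‖ * ‖y‖ := by
  rw [norm_def, norm_def, ← Real.sqrt_mul (norm_nonneg _)]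
  exact Real.le_sqrt_of_sq_le (P.norm_inner_sq_le x y)

theorem core : SeminormedSpace.Core ℂ P.carrier where
  norm_nonneg x := Real.sqrt_nonneg _
  norm_smul c x := by
    rw [norm_def, norm_def]
    simp only [map_smul, map_smulₛₗ, LinearMap.smul_apply, norm_smul, RCLike.norm_conj]
    rw [← mul_assoc, Real.sqrt_mul (by positivity), Real.sqrt_mul_self (norm_nonneg _)]
  norm_triangle x y := by
    have hx : 0 ≤ ‖x‖ := Real.sqrt_nonneg _
    have hy : 0 ≤ ‖y‖ := Real.sqrt_nonneg _
    refine le_of_sq_le_sq ?_ (add_nonneg hx hy)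
    rw [P.norm_sq_eq]
    simp only [map_add, LinearMap.add_apply]
    have h1 := P.norm_inner_le x y
    have h2 := P.norm_inner_le y x
    have h3 := P.norm_sq_eq x
    have h4 := P.norm_sq_eq y
    refine (norm_add_le _ _).trans ?_
    have h5 := norm_add_le (P.inner x x) (P.inner y x)
    have h6 := norm_add_le (P.inner x y) (P.inner y y)
    nlinarith

instance : SeminormedAddCommGroup P.carrier := SeminormedAddCommGroup.ofCore P.core

instance : NormedSpace ℂ P.carrier where
  norm_smul_le c x := (P.core.norm_smul c x).le

theorem norm_rmul_le (b : B) (x : P.carrier) : ‖P.rmul b x‖ ≤ ‖b‖ * ‖x‖ := by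
  refine le_of_sq_le_sq ?_ (by positivity)
  rw [P.norm_sq_eq, mul_pow, P.norm_sq_eq, P.inner_rmul, inner_rmul_left]
  refine (norm_mul_le _ _).trans ?_
  have := norm_mul_le (star b) (P.inner x x)
  rw [norm_star] at this
  nlinarith [norm_nonneg b]

theorem norm_act_le (a : A) (x : P.carrier) : ‖P.act a x‖ ≤ ‖a‖ * ‖x‖ := by
  refine le_of_sq_le_sq ?_ (by positivity)
  rw [P.norm_sq_eq, mul_pow, P.norm_sq_eq]
  obtain ⟨l, d, h1, h2⟩ := exists_unitization_sqrt a
  have h0 := P.inner_self_nonneg (l • x + P.act d x)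
  have h3 : P.inner (l • x + P.act d x) (l • x + P.act d x)
      = (‖a‖ ^ 2 : ℝ) • P.inner x x - P.inner (P.act a x) (P.act a x) := by
    have h4 := congrArg (fun z => P.inner x (P.act z x)) h2
    simp only [map_add, map_smul, map_neg, LinearMap.add_apply, LinearMap.smul_apply,
      LinearMap.neg_apply, P.act_mul] at h4
    rw [P.inner_act, sub_eq_add_neg, ← h4, ← Complex.coe_smul, ← h1, mul_comm (star l) l]
    simp only [map_add, map_smul, map_smulₛₗ, LinearMap.add_apply, LinearMap.smul_apply,
      P.inner_act, mul_smul, smul_add]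
    simp only [starRingEnd_apply]
    abel
  rw [h3, sub_nonneg] at h0
  have h5 := CStarAlgebra.norm_le_norm_of_nonneg_of_le (ha := P.inner_self_nonneg _) h0
  rwa [norm_smul, Real.norm_of_nonneg (by positivity)] at h5

/-- `ξ ↦ ξ b` as a continuous map. -/
def rmulL (b : B) : P.carrier →L[ℂ] P.carrier :=
  (P.rmul b).mkContinuous ‖b‖ (P.norm_rmul_le b)

/-- `ξ ↦ φ(a) ξ` as a continuous map. -/
def actL (a : A) : P.carrier →L[ℂ] P.carrier :=
  (P.act a).mkContinuous ‖a‖ (P.norm_act_le a)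

/-- `η ↦ ⟨ξ, η⟩`, extended to the completion. -/
def innerL (x : P.carrier) : Completion P.carrier →L[ℂ] B :=
  ((P.inner x).mkContinuous ‖x‖ (P.norm_inner_le x)).fromCompletion

theorem innerL_coe (x y : P.carrier) : P.innerL x (y : Completion P.carrier) = P.inner x y := by
  simp [innerL]

/-- `(ξ, η) ↦ ⟨ξ, η⟩` with `η` in the completion. -/
def innerL₂ : P.carrier →L⋆[ℂ] (Completion P.carrier →L[ℂ] B) :=
  LinearMap.mkContinuous
    { toFun := P.innerL
      map_add' := fun x y => by
        ext z
        induction z using Completion.induction_on with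
        | hp =>
          exact isClosed_eq (by fun_prop) (by fun_prop)
        | ih z => simp [innerL_coe]
      map_smul' := fun c x => by
        ext z
        induction z using Completion.induction_on with
        | hp =>
          exact isClosed_eq (by fun_prop) (by fun_prop)
        | ih z => simp [innerL_coe] } 1 <| fun x => by
    refine ContinuousLinearMap.opNorm_le_bound _ (by positivity) fun z => ?_
    induction z using Completion.induction_on with
    | hp => exact isClosed_le (by fun_prop) (by fun_prop)
    | ih z =>
      simp only [LinearMap.coe_mk, AddHom.coe_mk, innerL_coe, Completion.norm_coe, one_mul]
      exact P.norm_inner_le x z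

/-- The inner product on the completion. -/
def innerC : Completion P.carrier →L⋆[ℂ] (Completion P.carrier →L[ℂ] B) :=
  P.innerL₂.fromCompletion

theorem innerC_coe (x y : P.carrier) :
    P.innerC (x : Completion P.carrier) (y : Completion P.carrier) = P.inner x y := by
  simp [innerC, innerL₂, innerL_coe]

/-- Right multiplication on the completion. -/
def rmulC : B →ₗ[ℂ] Completion P.carrier →ₗ[ℂ] Completion P.carrier :=
  LinearMap.mk₂ ℂ (fun b x => (P.rmulL b).completion x)
    (fun b c x => by
      induction x using Completion.induction_on with
      | hp =>
        exact isClosed_eq (ContinuousLinearMap.continuous _)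
          ((ContinuousLinearMap.continuous _).add (ContinuousLinearMap.continuous _))
      | ih x => simp [rmulL, Completion.coe_add])
    (fun l b x => by
      induction x using Completion.induction_on with
      | hp =>
        exact isClosed_eq (ContinuousLinearMap.continuous _)
          ((ContinuousLinearMap.continuous _).const_smul l)
      | ih x => simp [rmulL, Completion.coe_smul])
    (fun _ _ _ => map_add _ _ _) (fun _ _ _ => map_smul _ _ _)

/-- The left action on the completion. -/
def actC : A →ₗ[ℂ] Completion P.carrier →ₗ[ℂ] Completion P.carrier :=
  LinearMap.mk₂ ℂ (fun b x => (P.actL b).completion x)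
    (fun b c x => by
      induction x using Completion.induction_on with
      | hp =>
        exact isClosed_eq (ContinuousLinearMap.continuous _)
          ((ContinuousLinearMap.continuous _).add (ContinuousLinearMap.continuous _))
      | ih x => simp [actL, Completion.coe_add])
    (fun l b x => by
      induction x using Completion.induction_on with
      | hp =>
        exact isClosed_eq (ContinuousLinearMap.continuous _)
          ((ContinuousLinearMap.continuous _).const_smul l)
      | ih x => simp [actL, Completion.coe_smul])
    (fun _ _ _ => map_add _ _ _) (fun _ _ _ => map_smul _ _ _)

/-- The inner product on the completion, as a sesquilinear map. -/
def innerCₗ : Completion P.carrier →ₗ⋆[ℂ] Completion P.carrier →ₗ[ℂ] B :=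
  (ContinuousLinearMap.coeLM ℂ).comp P.innerC.toLinearMap

theorem rmulC_coe (b : B) (x : P.carrier) :
    P.rmulC b (x : Completion P.carrier) = (P.rmul b x : P.carrier) := by
  simp [rmulC, rmulL]

theorem actC_coe (a : A) (x : P.carrier) :
    P.actC a (x : Completion P.carrier) = (P.act a x : P.carrier) := by
  simp [actC, actL]

theorem innerCₗ_coe (x y : P.carrier) :
    P.innerCₗ (x : Completion P.carrier) (y : Completion P.carrier) = P.inner x y :=
  P.innerC_coe x y

theorem continuous_rmulC (b : B) : Continuous (P.rmulC b) := (P.rmulL b).completion.continuous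

theorem continuous_actC (a : A) : Continuous (P.actC a) := (P.actL a).completion.continuous

theorem continuous_innerCₗ :
    Continuous fun p : Completion P.carrier × Completion P.carrier => P.innerCₗ p.1 p.2 := by
  change Continuous fun p : Completion P.carrier × Completion P.carrier => P.innerC p.1 p.2
  fun_prop

/-- The separated completion of a pre-correspondence: divide out the vectors of length zero,
complete, and extend all operations by continuity. -/
def completion : Correspondence A B where
  carrier := Completion P.carrier
  rmul := P.rmulC
  inner := P.innerCₗ
  act := P.actC
  rmul_mul b c x := by
    induction x using Completion.induction_on with
    | hp =>
      exact isClosed_eq (P.continuous_rmulC _)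
        ((P.continuous_rmulC _).comp (P.continuous_rmulC _))
    | ih x => simp only [rmulC_coe, P.rmul_mul]
  inner_rmul x y b := by
    induction x, y using Completion.induction_on₂ with
    | hp =>
      exact isClosed_eq
        (P.continuous_innerCₗ.comp
          (continuous_fst.prodMk ((P.continuous_rmulC b).comp continuous_snd)))
        (P.continuous_innerCₗ.mul continuous_const)
    | ih x y => simp only [rmulC_coe, innerCₗ_coe, P.inner_rmul]
  star_inner x y := by
    induction x, y using Completion.induction_on₂ with
    | hp =>
      exact isClosed_eq P.continuous_innerCₗ.star (P.continuous_innerCₗ.comp continuous_swap)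
    | ih x y => simp only [innerCₗ_coe, P.star_inner]
  inner_self_nonneg x := by
    induction x using Completion.induction_on with
    | hp =>
      exact CStarAlgebra.isClosed_nonneg.preimage
        (P.continuous_innerCₗ.comp (continuous_id.prodMk continuous_id))
    | ih x => simpa only [innerCₗ_coe] using P.inner_self_nonneg x
  norm_sq_eq x := by
    induction x using Completion.induction_on with
    | hp =>
      exact isClosed_eq (continuous_norm.pow 2)
        (P.continuous_innerCₗ.comp (continuous_id.prodMk continuous_id)).norm
    | ih x => simpa only [innerCₗ_coe, Completion.norm_coe] using P.norm_sq_eq x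
  act_mul a b x := by
    induction x using Completion.induction_on with
    | hp =>
      exact isClosed_eq (P.continuous_actC _)
        ((P.continuous_actC _).comp (P.continuous_actC _))
    | ih x => simp only [actC_coe, P.act_mul]
  inner_act a x y := by
    induction x, y using Completion.induction_on₂ with
    | hp =>
      exact isClosed_eq
        (P.continuous_innerCₗ.comp
          (((P.continuous_actC a).comp continuous_fst).prodMk continuous_snd))
        (P.continuous_innerCₗ.comp
          (continuous_fst.prodMk ((P.continuous_actC _).comp continuous_snd)))
    | ih x y => simp only [actC_coe, innerCₗ_coe, P.inner_act]

end PreCorrespondence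

/-! ### The interior tensor product -/

section Gram

variable {A B : Type u} [NonUnitalCStarAlgebra A] [PartialOrder A] [StarOrderedRing A]
  [NonUnitalCStarAlgebra B] [PartialOrder B] [StarOrderedRing B]

/-- The Gram matrix of finitely many vectors of a Hilbert module is of the form `C⋆ C`. -/
theorem Correspondence.exists_gram (X : Correspondence A B) {ι : Type} [Fintype ι] (x : ι → X) :
    ∃ c : ι → ι → B, ∀ i j, X.inner (x i) (x j) = ∑ k, star (c k i) * c k j := by
  set M : CStarMatrix ι ι B := CStarMatrix.ofMatrix fun i j => X.inner (x i) (x j) with hM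
  have hMa : ∀ i j, M i j = X.inner (x i) (x j) := fun _ _ => rfl
  have hsa : IsSelfAdjoint M := by
    ext i j
    rw [CStarMatrix.star_apply, hMa, hMa, X.star_inner]
  obtain ⟨N, hN0, hNM, hNz⟩ := exists_negPart M hsa
  have hNsa : star N = N := hN0.isSelfAdjoint
  obtain ⟨K, hK⟩ := exists_star_mul_self hN0
  have hL : N * N * N = star (K * N) * (K * N) := by
    rw [star_mul, hNsa, mul_assoc, mul_assoc, ← mul_assoc (star K), ← hK]
  have hdiag1 : ∀ i, 0 ≤ (N * M * N) i i := by
    intro i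
    have : (N * M * N) i i
        = X.inner (∑ j, X.rmul (N j i) (x j)) (∑ j, X.rmul (N j i) (x j)) := by
      have hl : ∀ a b : X, ∀ n : B, X.inner (X.rmul n a) b = star n * X.inner a b := by
        intro a b n
        rw [← X.star_inner, X.inner_rmul, star_mul, X.star_inner]
      have hs : ∀ a b, star (N a b) = N b a := fun a b => by
        rw [← CStarMatrix.star_apply, hNsa]
      simp only [map_sum, LinearMap.sum_apply, X.inner_rmul, hl, hs, CStarMatrix.mul_apply, hMa,
        Finset.sum_mul]
    rw [this]
    exact X.inner_self_nonneg _
  have hL0 : K * N = 0 := by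
    have hz : ∀ i, ∑ k, star ((K * N) k i) * (K * N) k i = 0 := by
      intro i
      have h1 := hdiag1 i
      rw [hNM, hL, CStarMatrix.neg_apply, CStarMatrix.mul_apply] at h1
      simp only [CStarMatrix.star_apply] at h1
      exact le_antisymm (neg_nonneg.mp h1)
        (Finset.sum_nonneg fun k _ => star_mul_self_nonneg _)
    ext k i
    have h2 := (Finset.sum_eq_zero_iff_of_nonneg fun k _ =>
      star_mul_self_nonneg ((K * N) k i)).mp (hz i) k (Finset.mem_univ k)
    exact (CStarRing.star_mul_self_eq_zero_iff _).mp h2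
  have hNN : N = 0 := by
    have h1 : star N * N = 0 := by
      rw [hNsa]; nth_rewrite 1 [hK]; rw [mul_assoc, hL0, mul_zero]
    exact (CStarRing.star_mul_self_eq_zero_iff _).mp h1
  have hM0 : 0 ≤ M := hNz hNN
  obtain ⟨S, hS⟩ := exists_star_mul_self hM0
  refine ⟨fun i j => S i j, fun i j => ?_⟩
  rw [← hMa, hS, CStarMatrix.mul_apply]
  simp only [CStarMatrix.star_apply]

end Gram

namespace Correspondence

variable {A B C : Type u} [NonUnitalCStarAlgebra A] [PartialOrder A] [StarOrderedRing A]
  [NonUnitalCStarAlgebra B] [PartialOrder B] [StarOrderedRing B]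
  [NonUnitalCStarAlgebra C] [PartialOrder C] [StarOrderedRing C]

/-- An inner product separates points. -/
theorem ext_inner (X : Correspondence A B) {x y : X} (h : ∀ z, X.inner z x = X.inner z y) :
    x = y := by
  have h1 : ‖x - y‖ ^ 2 = 0 := by rw [X.norm_sq_eq, map_sub, h, sub_self, norm_zero]
  rwa [sq_eq_zero_iff, norm_eq_zero, sub_eq_zero] at h1

/-- Adjointable maps are module maps. -/
theorem act_rmul (X : Correspondence A B) (a : A) (b : B) (x : X) :
    X.act a (X.rmul b x) = X.rmul b (X.act a x) := by
  refine X.ext_inner fun z => ?_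
  have h := fun y => X.inner_act (star a) z y
  rw [star_star] at h
  rw [← h, X.inner_rmul, X.inner_rmul, h]

/-- The semi-inner product on the algebraic tensor product:
`⟨ξ₁ ⊗ η₁, ξ₂ ⊗ η₂⟩ = ⟨η₁, φ(⟨ξ₁, ξ₂⟩) η₂⟩`. -/
def tensorInner (X : Correspondence A B) (Y : Correspondence B C) :
    (X ⊗[ℂ] Y) →ₗ⋆[ℂ] (X ⊗[ℂ] Y) →ₗ[ℂ] C :=
  TensorProduct.lift <|
    LinearMap.mk₂'ₛₗ (starRingEnd ℂ) (starRingEnd ℂ)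
      (fun x₁ y₁ => TensorProduct.lift <|
        LinearMap.mk₂ ℂ (fun x₂ y₂ => Y.inner y₁ (Y.act (X.inner x₁ x₂) y₂))
          (by intros; simp) (by intros; simp) (by intros; simp) (by intros; simp))
      (by intros; ext; simp) (by intros; ext; simp) (by intros; ext; simp) (by intros; ext; simp)

theorem tensorInner_tmul (X : Correspondence A B) (Y : Correspondence B C)
    (x₁ x₂ : X) (y₁ y₂ : Y) :
    tensorInner X Y (x₁ ⊗ₜ y₁) (x₂ ⊗ₜ y₂) = Y.inner y₁ (Y.act (X.inner x₁ x₂) y₂) := rfl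

theorem tensorInner_self_nonneg (X : Correspondence A B) (Y : Correspondence B C)
    (u : X ⊗[ℂ] Y) : 0 ≤ tensorInner X Y u u := by
  obtain ⟨n, x, y, rfl⟩ : ∃ (n : ℕ) (x : Fin n → X) (y : Fin n → Y), u = ∑ i, x i ⊗ₜ y i := by
    exact TensorProduct.exists_sum_tmul_eq u
  obtain ⟨c, hc⟩ := X.exists_gram x
  have : tensorInner X Y (∑ i, x i ⊗ₜ y i) (∑ i, x i ⊗ₜ y i)
      = ∑ k, Y.inner (∑ i, Y.act (c k i) (y i)) (∑ i, Y.act (c k i) (y i)) := by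
    simp only [map_sum, LinearMap.sum_apply, tensorInner_tmul, hc, Y.inner_act, Y.act_mul]
    rw [Finset.sum_congr rfl fun _ _ => Finset.sum_comm]
    exact Finset.sum_comm
  rw [this]
  exact Finset.sum_nonneg fun k _ => Y.inner_self_nonneg _

/-- The algebraic tensor product over `ℂ` of two correspondences, with
`(ξ ⊗ η) c = ξ ⊗ (η c)` and `φ(a) (ξ ⊗ η) = (φ(a) ξ) ⊗ η`. -/
def preTensor (X : Correspondence A B) (Y : Correspondence B C) : PreCorrespondence A C where
  carrier := X ⊗[ℂ] Y
  rmul := (LinearMap.lTensorHom X.carrier).comp Y.rmul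
  inner := tensorInner X Y
  act := (LinearMap.rTensorHom Y.carrier).comp X.act
  rmul_mul b c u := by
    induction u using TensorProduct.induction_on with
    | zero => simp
    | tmul x y => simp [Y.rmul_mul]
    | add u v hu hv => rw [map_add, hu, hv, map_add, map_add]
  inner_rmul u v b := by
    induction u using TensorProduct.induction_on with
    | zero => simp
    | add u₁ u₂ h₁ h₂ => simp only [map_add, LinearMap.add_apply, h₁, h₂, add_mul]
    | tmul x y =>
      induction v using TensorProduct.induction_on with
      | zero => simp
      | add v₁ v₂ h₁ h₂ => simp only [map_add, h₁, h₂, add_mul]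
      | tmul x' y' => simp [tensorInner_tmul, act_rmul, Y.inner_rmul]
  star_inner u v := by
    induction u using TensorProduct.induction_on with
    | zero => simp
    | add u₁ u₂ h₁ h₂ => simp only [map_add, LinearMap.add_apply, star_add, h₁, h₂]
    | tmul x y =>
      induction v using TensorProduct.induction_on with
      | zero => simp
      | add v₁ v₂ h₁ h₂ => simp only [map_add, LinearMap.add_apply, star_add, h₁, h₂]
      | tmul x' y' => rw [tensorInner_tmul, tensorInner_tmul, Y.star_inner, Y.inner_act,
          X.star_inner]
  inner_self_nonneg := tensorInner_self_nonneg X Y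
  act_mul a b u := by
    induction u using TensorProduct.induction_on with
    | zero => simp
    | tmul x y => simp [X.act_mul]
    | add u v hu hv => rw [map_add, hu, hv, map_add, map_add]
  inner_act a u v := by
    induction u using TensorProduct.induction_on with
    | zero => simp
    | add u₁ u₂ h₁ h₂ => simp only [map_add, LinearMap.add_apply, h₁, h₂]
    | tmul x y =>
      induction v using TensorProduct.induction_on with
      | zero => simp
      | add v₁ v₂ h₁ h₂ => simp only [map_add, h₁, h₂]
      | tmul x' y' => simp [tensorInner_tmul, X.inner_act]

/-- The interior tensor product `X ⊗_B Y`. The vectors `ξ b ⊗ η - ξ ⊗ φ(b) η` have length zero for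
the semi-inner product, so that they are divided out in the completion. -/
def tensor (X : Correspondence A B) (Y : Correspondence B C) : Correspondence A C :=
  (preTensor X Y).completion

/-- `E.tensorPowSucc n` is the tensor power `E^{⊗ (n + 1)}`. -/
def tensorPowSucc (E : Correspondence A A) : ℕ → Correspondence A A
  | 0 => E
  | n + 1 => E.tensor (E.tensorPowSucc n)

/-! ### Unitary equivalence and imprimitivity bimodules -/

/-- Unitary equivalence of `A`-`B`-correspondences. -/
def UnitarilyEquivalent (X Y : Correspondence A B) : Prop :=
  ∃ u : X ≃ₗ[ℂ] Y, (∀ x y, Y.inner (u x) (u y) = X.inner x y) ∧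
    (∀ a x, u (X.act a x) = Y.act a (u x)) ∧ ∀ b x, u (X.rmul b x) = Y.rmul b (u x)

/-- The left inner product of a Hilbert `A`-`B`-bimodule. (Its norm automatically agrees with that
of the right inner product, so that no separate completeness is needed.) -/
structure LeftInner (X : Correspondence A B) where
  toFun : X →ₗ[ℂ] X →ₗ⋆[ℂ] A
  act_left : ∀ a x y, toFun (X.act a x) y = a * toFun x y
  star_toFun : ∀ x y, star (toFun x y) = toFun y x
  self_nonneg : ∀ x, 0 ≤ toFun x x
  definite : ∀ x, toFun x x = 0 → x = 0
  act_toFun : ∀ x y z, X.act (toFun x y) z = X.rmul (X.inner y z) x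

/-- `X` is an `A`-`B`-imprimitivity bimodule: a Hilbert bimodule that is full on both sides. -/
def IsImprimitivity (X : Correspondence A B) : Prop :=
  Dense (Submodule.span ℂ {b : B | ∃ x y : X, X.inner x y = b} : Set B) ∧
    ∃ L : LeftInner X, Dense (Submodule.span ℂ {a : A | ∃ x y : X, L.toFun x y = a} : Set A)

end Correspondence

/-! ### The four relations -/

/-- A class of correspondences over arbitrary pairs of C⋆-algebras. -/
abbrev CorrClass : Type (u + 1) :=
  ∀ ⦃A B : Type u⦄ [NonUnitalCStarAlgebra A] [PartialOrder A] [StarOrderedRing A]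
    [NonUnitalCStarAlgebra B] [PartialOrder B] [StarOrderedRing B], Correspondence A B → Prop

/-- The class of all correspondences. -/
def allCorrespondences : CorrClass.{u} := fun _ _ _ _ _ _ _ _ _ => True

/-- The class of imprimitivity bimodules. -/
def imprimitivityBimodules : CorrClass.{u} := fun _ _ _ _ _ _ _ _ X => X.IsImprimitivity

section Relations

variable {A B : Type u} [NonUnitalCStarAlgebra A] [PartialOrder A] [StarOrderedRing A]
  [NonUnitalCStarAlgebra B] [PartialOrder B] [StarOrderedRing B]

/-- Strong Morita equivalence: `E ⊗ M ≈ M ⊗ F` for some imprimitivity bimodule `M`. -/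
def StrongMoritaEquivalent (E : Correspondence A A) (F : Correspondence B B) : Prop :=
  ∃ M : Correspondence A B, M.IsImprimitivity ∧ (E.tensor M).UnitarilyEquivalent (M.tensor F)

/-- Elementary strong shift equivalence inside the class `𝒞`: `E ≈ R ⊗ S` and `F ≈ S ⊗ R`, with
`R` and `S` in `𝒞`. -/
def ElementaryStrongShiftEquivalent (𝒞 : CorrClass.{u})
    (E : Correspondence A A) (F : Correspondence B B) : Prop :=
  ∃ (R : Correspondence A B) (S : Correspondence B A), 𝒞 R ∧ 𝒞 S ∧
    E.UnitarilyEquivalent (R.tensor S) ∧ F.UnitarilyEquivalent (S.tensor R)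

/-- Shift equivalence (with some lag `n + 1 ≥ 1`) inside the class `𝒞`: `E^{⊗ (n + 1)} ≈ R ⊗ S`,
`F^{⊗ (n + 1)} ≈ S ⊗ R`, `E ⊗ R ≈ R ⊗ F` and `S ⊗ E ≈ F ⊗ S`, with `R` and `S` in `𝒞`. -/
def ShiftEquivalent (𝒞 : CorrClass.{u})
    (E : Correspondence A A) (F : Correspondence B B) : Prop :=
  ∃ (n : ℕ) (R : Correspondence A B) (S : Correspondence B A), 𝒞 R ∧ 𝒞 S ∧
    (E.tensorPowSucc n).UnitarilyEquivalent (R.tensor S) ∧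
    (F.tensorPowSucc n).UnitarilyEquivalent (S.tensor R) ∧
    (E.tensor R).UnitarilyEquivalent (R.tensor F) ∧
    (S.tensor E).UnitarilyEquivalent (F.tensor S)

end Relations

/-- Strong shift equivalence inside the class `𝒞`: there is a chain `E = T₀, T₁, …, Tₙ = F`
(`n ≥ 0`, equality meaning unitary equivalence) of members of `𝒞`, over possibly different
C⋆-algebras, in which neighbours are elementary strong shift equivalent inside `𝒞`. -/
inductive StrongShiftEquivalent (𝒞 : CorrClass.{u}) :
    ∀ {A : Type u} [NonUnitalCStarAlgebra A] [PartialOrder A] [StarOrderedRing A]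
      {B : Type u} [NonUnitalCStarAlgebra B] [PartialOrder B] [StarOrderedRing B],
      Correspondence A A → Correspondence B B → Prop
  | refl {A : Type u} [NonUnitalCStarAlgebra A] [PartialOrder A] [StarOrderedRing A]
      {E F : Correspondence A A} (hE : 𝒞 E) (hF : 𝒞 F) (h : E.UnitarilyEquivalent F) :
      StrongShiftEquivalent 𝒞 E F
  | step {A : Type u} [NonUnitalCStarAlgebra A] [PartialOrder A] [StarOrderedRing A]
      {D : Type u} [NonUnitalCStarAlgebra D] [PartialOrder D] [StarOrderedRing D]
      {B : Type u} [NonUnitalCStarAlgebra B] [PartialOrder B] [StarOrderedRing B]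
      {E : Correspondence A A} {T : Correspondence D D} {F : Correspondence B B} (hE : 𝒞 E)
      (h : ElementaryStrongShiftEquivalent 𝒞 E T) (ht : StrongShiftEquivalent 𝒞 T F) :
      StrongShiftEquivalent 𝒞 E F

end CorrShift

end

/-! An imprimitivity bimodule `M` is invertible: its conjugate `N` satisfies M ⊗ N ≈ A and N ⊗ M ≈
B. Thus E ⊗ M ≈ M ⊗ F gives E ≈ (E ⊗ M) ⊗ N and F ≈ N ⊗ (E ⊗ M), an elementary strong shift
equivalence by imprimitivity bimodules. From there every other condition leads formally to shift
equivalence in the class of all correspondences: enlarging the class is harmless, and along a chain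
of elementary steps the intertwiners compose and the lags add.

The substance is the return from shift equivalence by arbitrary `R` and `S` to strong Morita
equivalence. The candidate is M = E ⊗ R, since E ⊗ M ≈ M ⊗ F follows at once from E ⊗ R ≈ R ⊗ F.
Both M ⊗ S and S ⊗ M are unitarily equivalent to tensor powers of `E` and `F`, hence are
imprimitivity bimodules. The second makes `M` full and `S` faithful, and `M` is nondegenerate
because `E` is. `IsImprimitivity.of_tensor` then lets `M` inherit the imprimitivity property from M
⊗ S.

That argument rests on describing imprimitivity without a chosen left inner product
(`isImprimitivity_iff`): the module is full, the left action is faithful, every rank-one operator is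
the action of some element of the left algebra, and such elements are total. A faithful action
bounds the norm of an element by that of its operator (`norm_le_of_act_le`), so these properties
need checking only on total sets. -/

namespace CorrShift

/-! ### Total sets and extension by continuity -/

/-- Induction over a total subset of a topological vector space. -/
theorem total_induction {V : Type*} [AddCommGroup V] [Module ℂ V] [TopologicalSpace V] {S : Set V}
    (hS : Dense (Submodule.span ℂ S : Set V)) {p : V → Prop} (closed : IsClosed {x | p x})
    (mem : ∀ x ∈ S, p x) (zero : p 0) (add : ∀ x y, p x → p y → p (x + y))
    (smul : ∀ (c : ℂ) x, p x → p (c • x)) (x : V) : p x := by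
  have h : (Submodule.span ℂ S : Set V) ⊆ {x | p x} := fun y hy =>
    Submodule.span_induction (p := fun y _ => p y) (fun x hx => mem x hx) zero
      (fun x y _ _ => add x y) (fun c x _ => smul c x) hy
  exact closed.closure_subset_iff.mpr h (hS x)

/-- Two continuous linear maps agreeing on a total set agree. -/
theorem eq_of_total {V W : Type*} [AddCommGroup V] [Module ℂ V] [TopologicalSpace V]
    [AddCommGroup W] [Module ℂ W] [TopologicalSpace W] [T2Space W] {σ : ℂ →+* ℂ} {S : Set V}
    (hS : Dense (Submodule.span ℂ S : Set V)) {f g : V →ₛₗ[σ] W} (hf : Continuous f)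
    (hg : Continuous g) (h : ∀ x ∈ S, f x = g x) (x : V) : f x = g x :=
  total_induction hS (isClosed_eq hf hg) h (by simp)
    (fun x y hx hy => by simp [hx, hy]) (fun c x hx => by simp [hx]) x

/-- If every member of a total set is in the closed span of `T`, then `T` is total. -/
theorem total_of_total {V : Type*} [NormedAddCommGroup V] [NormedSpace ℂ V] {S T : Set V}
    (hS : Dense (Submodule.span ℂ S : Set V))
    (h : ∀ x ∈ S, x ∈ (Submodule.span ℂ T).topologicalClosure) :
    Dense (Submodule.span ℂ T : Set V) := fun x =>
  total_induction (p := fun x => x ∈ (Submodule.span ℂ T).topologicalClosure) hS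
    (Submodule.isClosed_topologicalClosure _) h (zero_mem _) (fun _ _ => add_mem)
    (fun c _ => Submodule.smul_mem _ c) x

/-- If a continuous linear map sends a total set into the closed span of `T`, its values all lie
there. -/
theorem map_mem_closure_of_total {V W : Type*} [NormedAddCommGroup V] [NormedSpace ℂ V]
    [NormedAddCommGroup W] [NormedSpace ℂ W] {σ : ℂ →+* ℂ} {S : Set V} {K : Submodule ℂ W}
    (hS : Dense (Submodule.span ℂ S : Set V)) (f : V →ₛₗ[σ] W) (hf : Continuous f)
    (h : ∀ x ∈ S, f x ∈ K.topologicalClosure) (x : V) : f x ∈ K.topologicalClosure :=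
  total_induction (p := fun x => f x ∈ K.topologicalClosure) hS
    (K.isClosed_topologicalClosure.preimage hf) h (by simp)
    (fun x y hx hy => by rw [map_add]; exact add_mem hx hy)
    (fun c x hx => by rw [map_smulₛₗ]; exact Submodule.smul_mem _ _ hx) x

namespace Correspondence

variable {A B C D : Type u} [NonUnitalCStarAlgebra A] [PartialOrder A] [StarOrderedRing A]
  [NonUnitalCStarAlgebra B] [PartialOrder B] [StarOrderedRing B]
  [NonUnitalCStarAlgebra C] [PartialOrder C] [StarOrderedRing C]
  [NonUnitalCStarAlgebra D] [PartialOrder D] [StarOrderedRing D]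

/-! ### Norm estimates, continuity and density in Hilbert modules -/

section Basic

variable (X : Correspondence A B)

/-- The pre-correspondence underlying a correspondence. -/
abbrev toPre : PreCorrespondence A B where
  carrier := X
  rmul := X.rmul
  inner := X.inner
  act := X.act
  rmul_mul := X.rmul_mul
  inner_rmul := X.inner_rmul
  star_inner := X.star_inner
  inner_self_nonneg := X.inner_self_nonneg
  act_mul := X.act_mul
  inner_act := X.inner_act

theorem norm_eq_sqrt (x : X) : ‖x‖ = √‖X.inner x x‖ := by
  rw [← X.norm_sq_eq, Real.sqrt_sq (norm_nonneg _)]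

theorem norm_inner_le (x y : X) : ‖X.inner x y‖ ≤ ‖x‖ * ‖y‖ := by
  rw [norm_eq_sqrt, norm_eq_sqrt]
  exact X.toPre.norm_inner_le x y

theorem norm_rmul_le (b : B) (x : X) : ‖X.rmul b x‖ ≤ ‖b‖ * ‖x‖ := by
  rw [norm_eq_sqrt, norm_eq_sqrt]
  exact X.toPre.norm_rmul_le b x

theorem norm_act_le (a : A) (x : X) : ‖X.act a x‖ ≤ ‖a‖ * ‖x‖ := by
  rw [norm_eq_sqrt, norm_eq_sqrt]
  exact X.toPre.norm_act_le a x

theorem inner_rmul_left (x y : X) (b : B) :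
    X.inner (X.rmul b x) y = star b * X.inner x y :=
  X.toPre.inner_rmul_left x y b

theorem inner_act_right (x y : X) (a : A) :
    X.inner x (X.act a y) = X.inner (X.act (star a) x) y := by
  rw [X.inner_act, star_star]

theorem continuous_inner : Continuous fun p : X × X => X.inner p.1 p.2 := by
  let T : X →L⋆[ℂ] X →L[ℂ] B := LinearMap.mkContinuous₂ X.inner 1 fun x y => by
    rw [one_mul]; exact X.norm_inner_le x y
  exact (T.continuous.comp continuous_fst).clm_apply continuous_snd

theorem continuous_rmul : Continuous fun p : B × X => X.rmul p.1 p.2 :=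
  (X.rmul.mkContinuous₂ 1 fun x y => by
    rw [one_mul]; exact X.norm_rmul_le x y).continuous₂

theorem continuous_act : Continuous fun p : A × X => X.act p.1 p.2 :=
  (X.act.mkContinuous₂ 1 fun x y => by
    rw [one_mul]; exact X.norm_act_le x y).continuous₂

theorem continuous_inner_right (x : X) : Continuous (X.inner x) :=
  X.continuous_inner.comp (continuous_const.prodMk continuous_id)

theorem continuous_inner_left (y : X) : Continuous fun x => X.inner x y :=
  X.continuous_inner.comp (continuous_id.prodMk continuous_const)

theorem continuous_rmul_right (b : B) : Continuous (X.rmul b) :=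
  X.continuous_rmul.comp (continuous_const.prodMk continuous_id)

theorem continuous_rmul_left (x : X) : Continuous fun b => X.rmul b x :=
  X.continuous_rmul.comp (continuous_id.prodMk continuous_const)

theorem continuous_act_right (a : A) : Continuous (X.act a) :=
  X.continuous_act.comp (continuous_const.prodMk continuous_id)

theorem continuous_act_left (x : X) : Continuous fun a => X.act a x :=
  X.continuous_act.comp (continuous_id.prodMk continuous_const)

/-- Vectors with the same inner products against a total set agree. -/
theorem ext_inner_of_total {S : Set X} (hS : Dense (Submodule.span ℂ S : Set X)) {x y : X}
    (h : ∀ z ∈ S, X.inner z x = X.inner z y) : x = y :=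
  X.ext_inner fun z => eq_of_total (f := X.inner.flip x) (g := X.inner.flip y) hS
    (X.continuous_inner_left x) (X.continuous_inner_left y) h z

/-- A right Hilbert module is nondegenerate as a right module. -/
theorem total_rmul {S : Set X} (hS : Dense (Submodule.span ℂ S : Set X)) :
    Dense (Submodule.span ℂ (Set.image2 (fun (b : B) x => X.rmul b x) Set.univ S) : Set X) := by
  refine total_of_total hS fun x hx => ?_
  have happ := CStarAlgebra.increasingApproximateUnit B
  have hne := happ.neBot
  have hlim : Filter.Tendsto (fun e => X.rmul e x) (CStarAlgebra.approximateUnit B) (nhds x) := by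
    rw [tendsto_iff_norm_sub_tendsto_zero]
    -- With h = ⟨x, x⟩, expanding ⟨xe - x, xe - x⟩ gives the negative of the element under the norm
    -- here; it tends to zero along an approximate unit because he → h and ‖e‖ ≤ 1.
    have h1 : Filter.Tendsto (fun e => √‖X.inner x x * e - X.inner x x
        - (star e * (X.inner x x * e - X.inner x x))‖)
        (CStarAlgebra.approximateUnit B) (nhds 0) := by
      set h := X.inner x x
      have h2 : Filter.Tendsto (fun e => h * e - h) (CStarAlgebra.approximateUnit B) (nhds 0) := by
        have := (happ.tendsto_mul_left h).sub_const h
        rwa [sub_self] at this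
      have h3 : Filter.Tendsto (fun e => star e * (h * e - h)) (CStarAlgebra.approximateUnit B)
          (nhds 0) := by
        refine squeeze_zero_norm' ?_ (tendsto_norm_zero.comp h2)
        filter_upwards [happ.eventually_norm] with e he
        refine (norm_mul_le _ _).trans ?_
        rw [norm_star]
        exact mul_le_of_le_one_left (norm_nonneg _) he
      have h4 := (h2.sub h3).norm.sqrt
      simpa using h4
    refine h1.congr fun e => ?_
    rw [X.norm_eq_sqrt, ← norm_neg]
    congr 2
    simp only [map_sub, LinearMap.sub_apply, X.inner_rmul, inner_rmul_left, mul_sub, mul_assoc]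
    abel
  exact mem_closure_of_tendsto hlim
    (.of_forall fun e => Submodule.subset_span ⟨e, trivial, x, hx, rfl⟩)

/-- Nondegeneracy of the left action. -/
def Nondegenerate : Prop :=
  Dense (Submodule.span ℂ {x : X | ∃ (a : A) (y : X), X.act a y = x} : Set X)

/-- Fullness of the right inner product. -/
def Full : Prop := Dense (Submodule.span ℂ {b : B | ∃ x y : X, X.inner x y = b} : Set B)

/-- For a full right Hilbert module, the vectors `ξ ⟨η, ζ⟩` are total. -/
theorem Full.total_rmul_inner {X : Correspondence A B} (h : X.Full) :
    Dense (Submodule.span ℂ {w : X | ∃ x y z, X.rmul (X.inner y z) x = w} : Set X) := by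
  have huniv : Dense (Submodule.span ℂ (Set.univ : Set X) : Set X) := by simp
  refine total_of_total (X.total_rmul huniv) ?_
  rintro _ ⟨b, -, x, -, rfl⟩
  refine map_mem_closure_of_total h (X.rmul.flip x) (X.continuous_rmul_left x) ?_ b
  rintro _ ⟨y, z, rfl⟩
  exact Submodule.le_topologicalClosure _ (Submodule.subset_span ⟨x, y, z, rfl⟩)

/-- A faithful left action dominates the norm. -/
theorem norm_le_of_act_le (hinj : ∀ a : A, (∀ x, X.act a x = 0) → a = 0) (a : A) {t : ℝ}
    (ht : 0 ≤ t) (hat : ∀ x, ‖X.act a x‖ ≤ t * ‖x‖) : ‖a‖ ≤ t := by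
  by_contra! hlt
  have hpos : 0 ≤ star a * a := star_mul_self_nonneg a
  set h := star a * a with hh
  have hnorm : ‖h‖ = ‖a‖ * ‖a‖ := CStarRing.norm_star_mul_self
  -- Cut the spectrum of h = a⋆a at a level `s` strictly between t² and ‖a‖², and let b = f(h) with
  -- f(r) = max(r - s, 0). On the range of `b` the operator `a` expands by at least √s > t, so b
  -- acts as zero; faithfulness gives b = 0, which forces ‖h‖ ≤ s < ‖a‖².
  obtain ⟨s, hs1, hs2⟩ := exists_between (show t * t < ‖a‖ * ‖a‖ by nlinarith)
  have hs0 : 0 < s := lt_of_le_of_lt (by positivity) hs1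
  set f : ℝ → ℝ := fun r => max (r - s) 0 with hf
  have hf0 : f 0 = 0 := by simp [hf, hs0.le]
  have hfc : Continuous f := by fun_prop
  have hsa : IsSelfAdjoint h := hpos.isSelfAdjoint
  set b := cfcₙ f h with hb
  have hbsa : star b = b := (cfcₙ_predicate f h : IsSelfAdjoint b)
  have hord : s • (b * b) ≤ b * h * b := by
    have e1 : b * h * b = cfcₙ (fun r => f r * r * f r) h := by
      rw [cfcₙ_mul (fun r => f r * r) f h (by fun_prop) (by simp) (by fun_prop) hf0,
        cfcₙ_mul f (fun r => r) h (by fun_prop) hf0 (by fun_prop) rfl, cfcₙ_id' ℝ h]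
    have e2 : s • (b * b) = cfcₙ (fun r => s * (f r * f r)) h := by
      rw [cfcₙ_const_mul s (fun r => f r * f r) h (by fun_prop) (by simp [hf0]),
        cfcₙ_mul f f h (by fun_prop) hf0 (by fun_prop) hf0]
    rw [e1, e2]
    refine cfcₙ_mono (fun r _ => ?_) (by fun_prop) (by fun_prop) (by simp [hf0]) (by simp [hf0])
    rcases le_total r s with hrs | hrs
    · simp [hf, hrs]
    · have : 0 ≤ f r := le_max_right _ _
      nlinarith [mul_nonneg this this]
  have hb0 : b = 0 := by
    refine hinj b fun x => ?_
    have h1 : (0 : B) ≤ X.inner x (X.act (b * h * b - s • (b * b)) x) := by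
      obtain ⟨c, hc⟩ := exists_star_mul_self (sub_nonneg.mpr hord)
      rw [hc, X.act_mul, ← X.inner_act]
      exact X.inner_self_nonneg _
    have h2 : X.inner x (X.act (b * h * b) x) = X.inner (X.act a (X.act b x))
        (X.act a (X.act b x)) := by
      rw [X.inner_act, ← X.act_mul (star a), ← hh, X.inner_act, hbsa, X.act_mul, X.act_mul]
    have h3 : X.inner x (X.act (s • (b * b)) x) = (s : ℂ) • X.inner (X.act b x) (X.act b x) := by
      rw [X.inner_act, hbsa, ← X.act_mul, ← map_smul, ← LinearMap.smul_apply, ← map_smul,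
        Complex.coe_smul]
    rw [map_sub, LinearMap.sub_apply, map_sub, h2, h3, sub_nonneg, Complex.coe_smul] at h1
    have h4 := CStarAlgebra.norm_le_norm_of_nonneg_of_le
      (ha := smul_nonneg hs0.le (X.inner_self_nonneg _)) h1
    rw [norm_smul, ← X.norm_sq_eq, ← X.norm_sq_eq, Real.norm_of_nonneg hs0.le] at h4
    have h5 := hat (X.act b x)
    have h6 := norm_nonneg (X.act b x)
    have h7 := norm_nonneg (X.act a (X.act b x))
    have h8 : ‖X.act a (X.act b x)‖ ^ 2 ≤ (t * ‖X.act b x‖) ^ 2 := by gcongr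
    have h9 : (s - t * t) * ‖X.act b x‖ ^ 2 ≤ 0 := by nlinarith
    have h10 : ‖X.act b x‖ ^ 2 ≤ 0 := nonpos_of_mul_nonpos_right h9 (by linarith)
    exact norm_eq_zero.mp (pow_eq_zero_iff two_ne_zero |>.mp (le_antisymm h10 (sq_nonneg _)))
  -- A function whose functional calculus vanishes is zero on the quasispectrum, so no spectral
  -- value exceeds `s`.
  have hspec : ∀ r ∈ quasispectrum ℝ h, f r = 0 := by
    have : cfcₙ f h = cfcₙ (fun _ : ℝ => (0 : ℝ)) h := by rw [← hb, hb0, cfcₙ_const_zero]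
    exact eqOn_of_cfcₙ_eq_cfcₙ (R := ℝ) this hsa hfc.continuousOn hf0 continuousOn_const rfl
  have hle : ‖h‖ ≤ s := by
    rw [← cfcₙ_id' ℝ h]
    refine norm_cfcₙ_le fun r hr => ?_
    have h1 := hspec r hr
    have h2 : 0 ≤ r := quasispectrum_nonneg_of_nonneg h hpos r hr
    rw [Real.norm_of_nonneg h2]
    have := le_max_left (r - s) 0
    simp only [hf] at h1
    linarith
  linarith

end Basic

/-! ### Unitary equivalence -/

namespace UnitarilyEquivalent

variable {X Y Z : Correspondence A B}

theorem refl (X : Correspondence A B) : X.UnitarilyEquivalent X :=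
  ⟨LinearEquiv.refl ℂ X, fun _ _ => rfl, fun _ _ => rfl, fun _ _ => rfl⟩

theorem symm (h : X.UnitarilyEquivalent Y) : Y.UnitarilyEquivalent X := by
  obtain ⟨u, h1, h2, h3⟩ := h
  refine ⟨u.symm, fun x y => ?_, fun a x => ?_, fun b x => ?_⟩
  · rw [← h1, u.apply_symm_apply, u.apply_symm_apply]
  · rw [u.symm_apply_eq, h2, u.apply_symm_apply]
  · rw [u.symm_apply_eq, h3, u.apply_symm_apply]

theorem trans (h : X.UnitarilyEquivalent Y) (h' : Y.UnitarilyEquivalent Z) :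
    X.UnitarilyEquivalent Z := by
  obtain ⟨u, h1, h2, h3⟩ := h
  obtain ⟨v, k1, k2, k3⟩ := h'
  exact ⟨u.trans v, fun x y => by simp [h1, k1], fun a x => by simp [h2, k2],
    fun b x => by simp [h3, k3]⟩

instance : Trans (UnitarilyEquivalent (A := A) (B := B)) UnitarilyEquivalent
    UnitarilyEquivalent := ⟨trans⟩

end UnitarilyEquivalent

/-- Correspondences with total families that have the same inner products, and the same matrix
coefficients of the left actions, are unitarily equivalent. -/
theorem unitarilyEquivalent_of_total {X Y : Correspondence A B} {ι : Type*} (f : ι → X) (g : ι → Y)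
    (hf : Dense (Submodule.span ℂ (Set.range f) : Set X))
    (hg : Dense (Submodule.span ℂ (Set.range g) : Set Y))
    (hinner : ∀ i j, X.inner (f i) (f j) = Y.inner (g i) (g j))
    (hact : ∀ a i j, X.inner (f i) (X.act a (f j)) = Y.inner (g i) (Y.act a (g j))) :
    X.UnitarilyEquivalent Y := by
  have hf' : DenseRange (Finsupp.linearCombination ℂ f) := by
    rwa [DenseRange, ← LinearMap.coe_range, Finsupp.range_linearCombination]
  have hg' : DenseRange (Finsupp.linearCombination ℂ g) := by
    rwa [DenseRange, ← LinearMap.coe_range, Finsupp.range_linearCombination]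
  -- Equal Gram matrices give equal norms to corresponding linear combinations, so f i ↦ g i extends
  -- to an isometry of the completed spans.
  have hnorm : ∀ v : ι →₀ ℂ, ‖Finsupp.linearCombination ℂ g (LinearEquiv.refl ℂ _ v)‖
      = ‖Finsupp.linearCombination ℂ f v‖ := by
    intro v
    rw [Y.norm_eq_sqrt, X.norm_eq_sqrt]
    congr 2
    simp only [LinearEquiv.refl_apply, Finsupp.linearCombination_apply, Finsupp.sum, map_sum,
      LinearMap.sum_apply, map_smul, map_smulₛₗ, LinearMap.smul_apply, hinner]
  set u := (LinearEquiv.refl ℂ (ι →₀ ℂ)).extendOfIsometry _ _ hf' hg' hnorm with hu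
  have huf : ∀ i, u (f i) = g i := by
    intro i
    have := LinearEquiv.extendOfIsometry_eq (LinearEquiv.refl ℂ (ι →₀ ℂ)) _ _ hf' hg' hnorm
      (Finsupp.single i 1)
    simpa using this
  -- Stated for a pair of operators so that the identity maps give preservation of inner products
  -- and the left actions give left linearity. Right linearity then follows from inner products
  -- alone.
  have key : ∀ (S : X →ₗ[ℂ] X) (T : Y →ₗ[ℂ] Y), Continuous S → Continuous T →
      (∀ i j, X.inner (f i) (S (f j)) = Y.inner (g i) (T (g j))) →
      ∀ x y, X.inner x (S y) = Y.inner (u x) (T (u y)) := by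
    intro S T hS hT h x y
    refine eq_of_total (f := X.inner.flip (S y)) (g := (Y.inner.flip (T (u y))).comp
      u.toLinearEquiv.toLinearMap) hf (X.continuous_inner_left _)
      ((Y.continuous_inner_left _).comp u.continuous) ?_ x
    rintro _ ⟨i, rfl⟩
    refine eq_of_total (f := (X.inner (f i)).comp S) (g := (Y.inner (u (f i))).comp
      (T.comp u.toLinearEquiv.toLinearMap)) hf ((X.continuous_inner_right _).comp hS)
      ((Y.continuous_inner_right _).comp (hT.comp u.continuous)) ?_ y
    rintro _ ⟨j, rfl⟩
    change X.inner (f i) (S (f j)) = Y.inner (u (f i)) (T (u (f j)))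
    rw [huf, huf, h]
  have hin : ∀ x y, Y.inner (u x) (u y) = X.inner x y := fun x y =>
    (key LinearMap.id LinearMap.id continuous_id continuous_id hinner x y).symm
  refine ⟨u.toLinearEquiv, hin, fun a x => ?_, fun b x => ?_⟩
  · refine Y.ext_inner fun z => ?_
    obtain ⟨z, rfl⟩ := u.surjective z
    exact (hin _ _).trans (key (X.act a) (Y.act a) (X.continuous_act_right a)
      (Y.continuous_act_right a) (hact a) z x)
  · refine Y.ext_inner fun z => ?_
    obtain ⟨z, rfl⟩ := u.surjective z
    refine (hin _ _).trans ?_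
    rw [X.inner_rmul, Y.inner_rmul]
    exact congrArg (· * b) (hin _ _).symm

/-! ### Elementary tensors -/

section Tensor

variable (X : Correspondence A B) (Y : Correspondence B C)

/-- The elementary tensor `ξ ⊗ η`. -/
noncomputable def tmul : X →ₗ[ℂ] Y →ₗ[ℂ] X.tensor Y :=
  (TensorProduct.mk ℂ X Y).compr₂
    (Completion.toComplₗᵢ (𝕜 := ℂ) (E := (preTensor X Y).carrier)).toLinearMap

theorem inner_tmul (x x' : X) (y y' : Y) :
    (X.tensor Y).inner (tmul X Y x y) (tmul X Y x' y') = Y.inner y (Y.act (X.inner x x') y') :=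
  (preTensor X Y).innerCₗ_coe _ _

theorem act_tmul (a : A) (x : X) (y : Y) :
    (X.tensor Y).act a (tmul X Y x y) = tmul X Y (X.act a x) y :=
  (preTensor X Y).actC_coe _ _

theorem rmul_tmul (c : C) (x : X) (y : Y) :
    (X.tensor Y).rmul c (tmul X Y x y) = tmul X Y x (Y.rmul c y) :=
  (preTensor X Y).rmulC_coe _ _

theorem norm_tmul_le (x : X) (y : Y) : ‖tmul X Y x y‖ ≤ ‖x‖ * ‖y‖ := by
  refine le_of_sq_le_sq ?_ (by positivity)
  rw [(X.tensor Y).norm_sq_eq, inner_tmul, mul_pow]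
  refine (Y.norm_inner_le _ _).trans ?_
  have h1 := Y.norm_act_le (X.inner x x) y
  rw [← X.norm_sq_eq] at h1
  nlinarith [norm_nonneg y]

theorem continuous_tmul_left (y : Y) : Continuous fun x => tmul X Y x y :=
  (((tmul X Y).flip y).mkContinuous ‖y‖ fun x => by
    rw [mul_comm]; exact norm_tmul_le X Y x y).continuous

theorem continuous_tmul_right (x : X) : Continuous (tmul X Y x) :=
  ((tmul X Y x).mkContinuous ‖x‖ fun y => norm_tmul_le X Y x y).continuous

theorem total_tmul : Dense (Submodule.span ℂ {w : X.tensor Y | ∃ x y, tmul X Y x y = w} :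
    Set (X.tensor Y)) := by
  have h : DenseRange fun v : (preTensor X Y).carrier => (v : Completion (preTensor X Y).carrier) :=
    Completion.denseRange_coe
  refine Dense.mono ?_ h
  rintro _ ⟨v, rfl⟩
  refine TensorProduct.induction_on v ?_ (fun x y => Submodule.subset_span ⟨x, y, rfl⟩)
    fun v w hv hw => ?_
  · exact zero_mem (Submodule.span ℂ {w : X.tensor Y | ∃ x y, tmul X Y x y = w})
  · exact (congrArg (· ∈ Submodule.span ℂ {w : X.tensor Y | ∃ x y, tmul X Y x y = w})
      (Completion.coe_add (α := (preTensor X Y).carrier) v w)).mpr (add_mem hv hw)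

variable {X Y}

/-- Elementary tensors of members of total sets are total. -/
theorem total_tmul_of_total {S : Set X} {T : Set Y}
    (hS : Dense (Submodule.span ℂ S : Set X)) (hT : Dense (Submodule.span ℂ T : Set Y)) :
    Dense (Submodule.span ℂ (Set.image2 (fun x y => tmul X Y x y) S T) : Set (X.tensor Y)) := by
  refine total_of_total (total_tmul X Y) ?_
  rintro _ ⟨x, y, rfl⟩
  refine map_mem_closure_of_total hS ((tmul X Y).flip y) (continuous_tmul_left X Y y) ?_ x
  intro x hx
  refine map_mem_closure_of_total hT (tmul X Y x) (continuous_tmul_right X Y x) ?_ y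
  exact fun y hy => Submodule.le_topologicalClosure _ (Submodule.subset_span ⟨x, hx, y, hy, rfl⟩)

/-- Unitary equivalences out of a tensor product, given on elementary tensors. -/
theorem tensor_unitarilyEquivalent_of {Z : Correspondence A C} (g : X → Y → Z)
    (hg : Dense (Submodule.span ℂ {w : Z | ∃ x y, g x y = w} : Set Z))
    (hinner : ∀ x y x' y', Z.inner (g x y) (g x' y') = Y.inner y (Y.act (X.inner x x') y'))
    (hact : ∀ a x y, Z.act a (g x y) = g (X.act a x) y) :
    (X.tensor Y).UnitarilyEquivalent Z := by
  have e1 : Set.range (fun p : X × Y => tmul X Y p.1 p.2) = {w | ∃ x y, tmul X Y x y = w} := by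
    ext w; simp
  have e2 : Set.range (fun p : X × Y => g p.1 p.2) = {w | ∃ x y, g x y = w} := by
    ext w; simp
  refine unitarilyEquivalent_of_total (fun p : X × Y => tmul X Y p.1 p.2)
    (fun p : X × Y => g p.1 p.2) (e1 ▸ total_tmul X Y) (e2 ▸ hg)
    (fun p q => by rw [inner_tmul, hinner]) (fun a p q => by
      rw [act_tmul, inner_tmul, hact, hinner])

theorem UnitarilyEquivalent.tensor {X' : Correspondence A B} {Y' : Correspondence B C}
    (hX : X.UnitarilyEquivalent X') (hY : Y.UnitarilyEquivalent Y') :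
    (X.tensor Y).UnitarilyEquivalent (X'.tensor Y') := by
  obtain ⟨u, h1, h2, h3⟩ := hX
  obtain ⟨v, k1, k2, k3⟩ := hY
  refine tensor_unitarilyEquivalent_of (fun x y => tmul X' Y' (u x) (v y)) ?_
    (fun x y x' y' => by rw [inner_tmul, h1, ← k2, k1]) (fun a x y => by rw [act_tmul, h2])
  refine (total_tmul X' Y').mono (Submodule.span_mono ?_)
  rintro _ ⟨x, y, rfl⟩
  exact ⟨u.symm x, v.symm y, by simp⟩

theorem tensor_congr_left {X' : Correspondence A B} (Y : Correspondence B C)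
    (hX : X.UnitarilyEquivalent X') : (X.tensor Y).UnitarilyEquivalent (X'.tensor Y) :=
  hX.tensor (.refl Y)

theorem tensor_congr_right (X : Correspondence A B) {Y' : Correspondence B C}
    (hY : Y.UnitarilyEquivalent Y') : (X.tensor Y).UnitarilyEquivalent (X.tensor Y') :=
  (UnitarilyEquivalent.refl X).tensor hY

/-- The two families of triple elementary tensors are total, and both have inner product ⟨z, ⟨y, ⟨x,
x'⟩ y'⟩ z'⟩. -/
theorem tensor_assoc (X : Correspondence A B) (Y : Correspondence B C) (Z : Correspondence C D) :
    ((X.tensor Y).tensor Z).UnitarilyEquivalent (X.tensor (Y.tensor Z)) := by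
  refine unitarilyEquivalent_of_total
    (fun p : X × Y × Z => tmul (X.tensor Y) Z (tmul X Y p.1 p.2.1) p.2.2)
    (fun p : X × Y × Z => tmul X (Y.tensor Z) p.1 (tmul Y Z p.2.1 p.2.2)) ?_ ?_ ?_ ?_
  · refine (total_tmul_of_total (total_tmul X Y) (T := (Set.univ : Set Z)) (by simp)).mono
      (Submodule.span_mono ?_)
    rintro _ ⟨_, ⟨x, y, rfl⟩, z, -, rfl⟩
    exact ⟨(x, y, z), rfl⟩
  · refine (total_tmul_of_total (S := (Set.univ : Set X)) (by simp) (total_tmul Y Z)).mono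
      (Submodule.span_mono ?_)
    rintro _ ⟨x, -, _, ⟨y, z, rfl⟩, rfl⟩
    exact ⟨(x, y, z), rfl⟩
  · intro p q
    simp only [inner_tmul, act_tmul]
  · intro a p q
    simp only [inner_tmul, act_tmul]

end Tensor

/-! ### Rank-one operators and imprimitivity bimodules -/

/-- Injectivity of the left action. -/
def Faithful (X : Correspondence A B) : Prop := ∀ a : A, (∀ x, X.act a x = 0) → a = 0

/-- The left action of `a` is the rank-one operator `ζ ↦ ξ ⟨η, ζ⟩`. -/
def IsRankOne (X : Correspondence A B) (a : A) (x y : X) : Prop :=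
  ∀ z, X.act a z = X.rmul (X.inner y z) x

section RankOne

variable {X : Correspondence A B}

theorem Faithful.ext (h : X.Faithful) {a b : A} (hab : ∀ x, X.act a x = X.act b x) : a = b :=
  sub_eq_zero.mp <| h _ fun x => by rw [map_sub, LinearMap.sub_apply, hab, sub_self]

theorem IsRankOne.unique (h : X.Faithful) {a b : A} {x y : X} (ha : X.IsRankOne a x y)
    (hb : X.IsRankOne b x y) : a = b :=
  h.ext fun z => by rw [ha, hb]

theorem IsRankOne.zero (y : X) : X.IsRankOne 0 0 y := fun z => by simp

theorem IsRankOne.add {a b : A} {x x' y : X} (ha : X.IsRankOne a x y)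
    (hb : X.IsRankOne b x' y) : X.IsRankOne (a + b) (x + x') y := fun z => by
  simp [ha z, hb z]

theorem IsRankOne.smul (c : ℂ) {a : A} {x y : X} (ha : X.IsRankOne a x y) :
    X.IsRankOne (c • a) (c • x) y := fun z => by
  simp [ha z]

theorem IsRankOne.sub {a b : A} {x x' y : X} (ha : X.IsRankOne a x y)
    (hb : X.IsRankOne b x' y) : X.IsRankOne (a - b) (x - x') y := fun z => by
  simp [ha z, hb z]

theorem IsRankOne.act (c : A) {a : A} {x y : X} (ha : X.IsRankOne a x y) :
    X.IsRankOne (c * a) (X.act c x) y := fun z => by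
  rw [X.act_mul, ha, X.act_rmul]

theorem IsRankOne.star {a : A} {x y : X} (ha : X.IsRankOne a x y) :
    X.IsRankOne (star a) y x := fun z => X.ext_inner fun w => by
  rw [inner_act_right, star_star, ha, inner_rmul_left, X.star_inner, X.inner_rmul]

theorem IsRankOne.norm_le (h : X.Faithful) {a : A} {x y : X} (ha : X.IsRankOne a x y) :
    ‖a‖ ≤ ‖x‖ * ‖y‖ := by
  refine X.norm_le_of_act_le h a (by positivity) fun z => ?_
  rw [ha]
  have h1 := X.norm_rmul_le (X.inner y z) x
  have h2 := X.norm_inner_le y z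
  nlinarith [norm_nonneg x]

/-- By `IsRankOne.norm_le`, convergent vectors give a Cauchy sequence of implementing elements,
whose limit implements the limiting rank-one operator. -/
theorem isClosed_setOf_isRankOne (h : X.Faithful) (y : X) :
    IsClosed {x | ∃ a, X.IsRankOne a x y} := by
  refine isClosed_of_closure_subset fun x hx => ?_
  obtain ⟨v, hv, hlim⟩ := mem_closure_iff_seq_limit.mp hx
  choose a ha using hv
  have hc : CauchySeq a := by
    -- Scaling by ‖y‖, instead of dividing ε by it, covers y = 0 as well.
    have hs : CauchySeq fun n => (‖y‖ : ℂ) • v n := (hlim.const_smul _).cauchySeq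
    rw [Metric.cauchySeq_iff] at hs ⊢
    intro ε hε
    obtain ⟨N, hN⟩ := hs ε hε
    refine ⟨N, fun m hm n hn => lt_of_le_of_lt ?_ (hN m hm n hn)⟩
    rw [dist_eq_norm, dist_eq_norm, ← smul_sub, norm_smul, Complex.norm_real, norm_norm, mul_comm]
    exact ((ha m).sub (ha n)).norm_le h
  obtain ⟨b, hb⟩ := cauchySeq_tendsto_of_complete hc
  refine ⟨b, fun z => ?_⟩
  have h1 := ((X.continuous_act_left z).tendsto b).comp hb
  have h2 := ((X.continuous_rmul_right (X.inner y z)).tendsto x).comp hlim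
  refine tendsto_nhds_unique h1 (h2.congr fun n => (ha n z).symm)

/-- If all rank-one operators built from total sets come from the left action, then all do. -/
theorem exists_isRankOne_of_total (h : X.Faithful) {S T : Set X}
    (hS : Dense (Submodule.span ℂ S : Set X)) (hT : Dense (Submodule.span ℂ T : Set X))
    (hST : ∀ x ∈ S, ∀ y ∈ T, ∃ a, X.IsRankOne a x y) (x y : X) : ∃ a, X.IsRankOne a x y := by
  have step : ∀ {S : Set X}, Dense (Submodule.span ℂ S : Set X) → ∀ y : X,
      (∀ x ∈ S, ∃ a, X.IsRankOne a x y) → ∀ x, ∃ a, X.IsRankOne a x y := fun hS y hy =>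
    total_induction hS (isClosed_setOf_isRankOne h y) hy ⟨0, .zero y⟩
      (fun _ _ ⟨a, ha⟩ ⟨b, hb⟩ => ⟨a + b, ha.add hb⟩) (fun c _ ⟨a, ha⟩ => ⟨c • a, ha.smul c⟩)
  refine step hS y (fun x hx => ?_) x
  -- Taking adjoints exchanges the two vectors, so closedness in the first variable serves for both.
  have h' : ∀ y ∈ T, ∃ a, X.IsRankOne a y x := fun y hy =>
    let ⟨a, ha⟩ := hST x hx y hy
    ⟨_, ha.star⟩
  obtain ⟨a, ha⟩ := step hT x h' y
  exact ⟨_, ha.star⟩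

theorem isRankOne_of_total {S : Set X} (hS : Dense (Submodule.span ℂ S : Set X)) {a : A} {x y : X}
    (h : ∀ z ∈ S, X.act a z = X.rmul (X.inner y z) x) : X.IsRankOne a x y :=
  eq_of_total (f := X.act a) (g := (X.rmul.flip x).comp (X.inner y)) hS
    (X.continuous_act_right a) ((X.continuous_rmul_left x).comp (X.continuous_inner_right y)) h

/-- Testing on vectors Nz, with `N` the negative part of `a`, gives ⟨z, NaN z⟩ = -⟨z, N³ z⟩, which
is both nonnegative and nonpositive. Writing N = K⋆K, this says KN acts as zero, hence KN = 0 and N²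
= 0. -/
theorem Faithful.nonneg (h : X.Faithful) {a : A} (ha : IsSelfAdjoint a)
    (hpos : ∀ z, 0 ≤ X.inner z (X.act a z)) : 0 ≤ a := by
  obtain ⟨N, hN0, hNa, hNz⟩ := exists_negPart a ha
  have hNsa : star N = N := hN0.isSelfAdjoint
  obtain ⟨K, hK⟩ := exists_star_mul_self hN0
  have hL : N * N * N = star (K * N) * (K * N) := by
    rw [star_mul, hNsa, mul_assoc, mul_assoc, ← mul_assoc (star K), ← hK]
  have hKN : K * N = 0 := by
    refine h _ fun z => ?_
    have h1 := hpos (X.act N z)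
    rw [X.inner_act, hNsa, ← X.act_mul, ← X.act_mul, hNa, hL, map_neg,
      LinearMap.neg_apply, map_neg, X.act_mul, ← X.inner_act, neg_nonneg] at h1
    have h2 := le_antisymm h1 (X.inner_self_nonneg _)
    have h3 := X.norm_sq_eq (X.act (K * N) z)
    rwa [h2, norm_zero, sq_eq_zero_iff, norm_eq_zero] at h3
  refine hNz ((CStarRing.star_mul_self_eq_zero_iff _).mp ?_)
  rw [hNsa]
  nth_rewrite 1 [hK]
  rw [mul_assoc, hKN, mul_zero]

end RankOne

/-! ### The left inner product -/

namespace LeftInner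

variable {X : Correspondence A B} (L : X.LeftInner)

theorem isRankOne (x y : X) : X.IsRankOne (L.toFun x y) x y := L.act_toFun x y

/-- If `a` acts as zero, then a · L(x, y) = L(ax, y) = 0, so `a` annihilates all of A by density, in
particular a⋆. -/
theorem faithful (hL : Dense (Submodule.span ℂ {a : A | ∃ x y : X, L.toFun x y = a} : Set A)) :
    X.Faithful := by
  intro a ha
  have h : ∀ c : A, a * c = 0 := by
    refine eq_of_total (f := LinearMap.mulLeft ℂ a) (g := 0) hL (continuous_const_mul a)
      continuous_zero ?_
    rintro _ ⟨x, y, rfl⟩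
    change a * _ = 0
    rw [← L.act_left, ha, map_zero, LinearMap.zero_apply]
  exact (CStarRing.mul_star_self_eq_zero_iff a).mp (h _)

theorem toFun_act_right (x y : X) (a : A) :
    L.toFun x (X.act a y) = L.toFun x y * star a := by
  rw [← L.star_toFun, L.act_left, star_mul, L.star_toFun]

theorem continuous_left (h : X.Faithful) (y : X) : Continuous fun x => L.toFun x y :=
  ((L.toFun.flip y).mkContinuous ‖y‖ fun x => by
    rw [mul_comm]; exact (L.isRankOne x y).norm_le h).continuous

theorem continuous_right (h : X.Faithful) (x : X) : Continuous (L.toFun x) :=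
  ((L.toFun x).mkContinuous ‖x‖ fun y => (L.isRankOne x y).norm_le h).continuous

theorem toFun_rmul_left (h : X.Faithful) (x y : X) (b : B) :
    L.toFun (X.rmul b x) y = L.toFun x (X.rmul (star b) y) :=
  h.ext fun z => by
    rw [L.act_toFun, L.act_toFun, ← X.rmul_mul, inner_rmul_left, star_star]

/-- The upper bound is the rank-one estimate; the lower one comes from ⟨x, L(x, x) x⟩ = ⟨x, x⟩². The
equality lets the dual module keep the norm, and so the completeness, of `X`. -/
theorem norm_toFun_self (h : X.Faithful) (x : X) : ‖L.toFun x x‖ = ‖x‖ ^ 2 := by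
  refine le_antisymm (((L.isRankOne x x).norm_le h).trans_eq (sq _).symm) ?_
  have h1 : ‖X.act (L.toFun x x) x‖ ≤ _ := X.norm_act_le _ _
  have h2 : ‖X.inner x (X.act (L.toFun x x) x)‖ = ‖x‖ ^ 2 * ‖x‖ ^ 2 := by
    rw [L.act_toFun, X.inner_rmul, X.norm_sq_eq]
    have := CStarRing.norm_star_mul_self (x := X.inner x x)
    rwa [X.star_inner] at this
  have h3 := X.norm_inner_le x (X.act (L.toFun x x) x)
  rcases (norm_nonneg x).eq_or_lt with h0 | h0
  · rw [← h0]; simp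
  · have h4 : ‖x‖ ^ 2 * ‖x‖ ^ 2 ≤ ‖x‖ * (‖L.toFun x x‖ * ‖x‖) :=
      h2 ▸ h3.trans (by gcongr)
    have h5 : ‖x‖ ^ 2 * ‖x‖ ^ 2 ≤ ‖L.toFun x x‖ * ‖x‖ ^ 2 := h4.trans_eq (by ring)
    exact le_of_mul_le_mul_right h5 (by positivity)

end LeftInner

/-- Imprimitivity bimodules in terms of rank-one operators. -/
theorem isImprimitivity_iff {X : Correspondence A B} : X.IsImprimitivity ↔
    X.Full ∧ X.Faithful ∧ (∀ x y, ∃ a, X.IsRankOne a x y) ∧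
      Dense (Submodule.span ℂ {a : A | ∃ x y, X.IsRankOne a x y} : Set A) := by
  constructor
  · rintro ⟨h, L, hL⟩
    refine ⟨h, L.faithful hL, fun x y => ⟨_, L.isRankOne x y⟩,
      hL.mono (Submodule.span_mono ?_)⟩
    rintro _ ⟨x, y, rfl⟩
    exact ⟨x, y, L.isRankOne x y⟩
  · rintro ⟨h, hinj, hex, hd⟩
    -- By faithfulness the element implementing a rank-one operator is unique, so each identity
    -- required of the left inner product can be read off from the operators.
    choose l hl using hex
    have hstar : ∀ x y, star (l x y) = l y x := fun x y =>
      (hl x y).star.unique hinj (hl y x)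
    have hadd : ∀ x x' y, l (x + x') y = l x y + l x' y := fun x x' y =>
      (hl _ _).unique hinj ((hl x y).add (hl x' y))
    have hsmul : ∀ (c : ℂ) x y, l (c • x) y = c • l x y := fun c x y =>
      (hl _ _).unique hinj ((hl x y).smul c)
    refine ⟨h, ⟨LinearMap.mk₂'ₛₗ (RingHom.id ℂ) (starRingEnd ℂ) l hadd hsmul
      (fun x y y' => ?_) (fun c x y => ?_), fun a x y => ?_, hstar, fun x => ?_, fun x hx => ?_,
      hl⟩, hd.mono (Submodule.span_mono ?_)⟩
    · rw [← hstar, hadd, star_add, hstar, hstar]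
    · rw [← hstar, hsmul, star_smul, hstar]; rfl
    · exact (hl _ _).unique hinj ((hl x y).act a)
    · refine hinj.nonneg (hstar x x) fun z => ?_
      change 0 ≤ X.inner z (X.act (l x x) z)
      rw [hl, X.inner_rmul, ← X.star_inner x z]
      exact star_mul_self_nonneg _
    -- If l(x, x) = 0 then x⟨x, x⟩ = 0; pairing with `x` gives ⟨x, x⟩² = 0.
    · have h1 := hl x x x
      rw [show l x x = 0 from hx, map_zero, LinearMap.zero_apply] at h1
      have h2 := congrArg (X.inner x) h1
      rw [map_zero, X.inner_rmul] at h2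
      nth_rewrite 1 [← X.star_inner] at h2
      have h3 := (CStarRing.star_mul_self_eq_zero_iff _).mp h2.symm
      have h4 := X.norm_sq_eq x
      rwa [h3, norm_zero, sq_eq_zero_iff, norm_eq_zero] at h4
    · rintro a ⟨x, y, ha⟩
      exact ⟨x, y, (hl x y).unique hinj ha⟩

theorem IsImprimitivity.full {X : Correspondence A B} (h : X.IsImprimitivity) : X.Full := h.1

theorem IsImprimitivity.faithful {X : Correspondence A B} (h : X.IsImprimitivity) : X.Faithful :=
  (isImprimitivity_iff.mp h).2.1

/-- The vectors x⟨y, z⟩ are total by fullness, and each is the action on `z` of the element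
implementing the rank-one operator of `x` and `y`. -/
theorem IsImprimitivity.nondegenerate {X : Correspondence A B} (h : X.IsImprimitivity) :
    X.Nondegenerate := by
  obtain ⟨-, -, hex, -⟩ := isImprimitivity_iff.mp h
  refine h.full.total_rmul_inner.mono (Submodule.span_mono ?_)
  rintro _ ⟨x, y, z, rfl⟩
  obtain ⟨a, ha⟩ := hex x y
  exact ⟨a, z, ha z⟩

theorem Nondegenerate.total_act {X : Correspondence A B} (h : X.Nondegenerate) {S : Set A}
    (hS : Dense (Submodule.span ℂ S : Set A)) :
    Dense (Submodule.span ℂ {w : X | ∃ a ∈ S, ∃ x, X.act a x = w} : Set X) := by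
  refine total_of_total h ?_
  rintro _ ⟨a, x, rfl⟩
  refine map_mem_closure_of_total hS (X.act.flip x) (X.continuous_act_left x) ?_ a
  exact fun a ha => Submodule.le_topologicalClosure _ (Submodule.subset_span ⟨a, ha, x, rfl⟩)

/-- Imprimitivity bimodules are closed under unitary equivalence. -/
theorem UnitarilyEquivalent.isImprimitivity {X Y : Correspondence A B}
    (h : X.UnitarilyEquivalent Y) (hX : X.IsImprimitivity) : Y.IsImprimitivity := by
  obtain ⟨u, h1, h2, h3⟩ := h
  obtain ⟨hfull, hinj, hex, hd⟩ := isImprimitivity_iff.mp hX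
  have hr : ∀ {a x y}, X.IsRankOne a x y → Y.IsRankOne a (u x) (u y) := fun ha z => by
    obtain ⟨z, rfl⟩ := u.surjective z
    rw [← h2, ha, h3, h1]
  refine isImprimitivity_iff.mpr ⟨hfull.mono (Submodule.span_mono ?_), fun a ha => hinj a fun x => ?_,
    fun x y => ?_, hd.mono (Submodule.span_mono ?_)⟩
  · rintro _ ⟨x, y, rfl⟩
    exact ⟨u x, u y, h1 x y⟩
  · rw [← u.map_eq_zero_iff, h2, ha]
  · obtain ⟨x, rfl⟩ := u.surjective x
    obtain ⟨y, rfl⟩ := u.surjective y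
    obtain ⟨a, ha⟩ := hex x y
    exact ⟨a, hr ha⟩
  · rintro a ⟨x, y, ha⟩
    exact ⟨u x, u y, hr ha⟩

/-! ### Tensor products of imprimitivity bimodules -/

section Tensor

variable {X : Correspondence A B} {Y : Correspondence B C}

theorem tmul_rmul (x : X) (b : B) (y : Y) :
    tmul X Y (X.rmul b x) y = tmul X Y x (Y.act b y) := by
  refine (X.tensor Y).ext_inner_of_total (total_tmul X Y) ?_
  rintro _ ⟨x', y', rfl⟩
  rw [inner_tmul, inner_tmul, X.inner_rmul, Y.act_mul]

/-- Over a faithful second factor, `ξ ⊗ η = 0` for all `η` only if `ξ = 0`. -/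
theorem eq_zero_of_tmul_eq_zero (hY : Y.Faithful) {x : X} (h : ∀ y, tmul X Y x y = 0) : x = 0 := by
  obtain ⟨s, hs⟩ := exists_star_mul_self (X.inner_self_nonneg x)
  have h1 : s = 0 := by
    refine hY s fun y => ?_
    have h2 := inner_tmul X Y x x y y
    rw [h, map_zero, hs, Y.act_mul, ← Y.inner_act] at h2
    have h3 := Y.norm_sq_eq (Y.act s y)
    rwa [← h2, norm_zero, sq_eq_zero_iff, norm_eq_zero] at h3
  have h4 := X.norm_sq_eq x
  rwa [hs, h1, mul_zero, norm_zero, sq_eq_zero_iff, norm_eq_zero] at h4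

/-- Inner products of elementary tensors are themselves inner products of vectors of `Y`. -/
theorem Full.of_tensor (h : (X.tensor Y).Full) : Y.Full := by
  refine total_of_total h ?_
  rintro _ ⟨u, v, rfl⟩
  refine map_mem_closure_of_total (total_tmul X Y) ((X.tensor Y).inner u)
    ((X.tensor Y).continuous_inner_right u) ?_ v
  rintro _ ⟨x, y, rfl⟩
  refine map_mem_closure_of_total (total_tmul X Y) ((X.tensor Y).inner.flip (tmul X Y x y))
    ((X.tensor Y).continuous_inner_left _) ?_ u
  rintro _ ⟨x', y', rfl⟩
  exact Submodule.le_topologicalClosure _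
    (Submodule.subset_span ⟨y', Y.act (X.inner x' x) y, (inner_tmul X Y x' x y' y).symm⟩)

theorem Faithful.of_tensor (h : (X.tensor Y).Faithful) : X.Faithful := fun a ha => by
  refine h a fun z => eq_of_total (f := (X.tensor Y).act a) (g := 0) (total_tmul X Y)
    ((X.tensor Y).continuous_act_right a) continuous_zero ?_ z
  rintro _ ⟨x, y, rfl⟩
  rw [act_tmul, ha, map_zero]; rfl

theorem Faithful.tensor (hX : X.Faithful) (hY : Y.Faithful) : (X.tensor Y).Faithful := fun a ha =>
  hX a fun x => eq_zero_of_tmul_eq_zero hY fun y => by rw [← act_tmul, ha]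

theorem Nondegenerate.tensor (hX : X.Nondegenerate) : (X.tensor Y).Nondegenerate := by
  refine (total_tmul_of_total hX (T := (Set.univ : Set Y)) (by simp)).mono (Submodule.span_mono ?_)
  rintro _ ⟨_, ⟨a, x, rfl⟩, y, -, rfl⟩
  exact ⟨a, tmul X Y x y, act_tmul X Y a x y⟩

theorem Full.tensor (hX : X.Full) (hY : Y.Full) (hY' : Y.Nondegenerate) : (X.tensor Y).Full := by
  refine total_of_total hY ?_
  rintro _ ⟨y, y', rfl⟩
  refine map_mem_closure_of_total hY' (Y.inner y) (Y.continuous_inner_right y) ?_ y'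
  rintro _ ⟨b, z, rfl⟩
  refine map_mem_closure_of_total hX ((Y.inner y).comp (Y.act.flip z))
    ((Y.continuous_inner_right y).comp (Y.continuous_act_left z)) ?_ b
  rintro _ ⟨x, x', rfl⟩
  exact Submodule.le_topologicalClosure _ (Submodule.subset_span
    ⟨tmul X Y x y, tmul X Y x' z, inner_tmul X Y x x' y z⟩)

/-- Rank-one operators on a tensor product. -/
theorem IsRankOne.tensor {a : A} {b : B} {x x' : X} {y y' : Y} (hb : Y.IsRankOne b y y')
    (ha : X.IsRankOne a (X.rmul b x) x') :
    (X.tensor Y).IsRankOne a (tmul X Y x y) (tmul X Y x' y') := by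
  refine isRankOne_of_total (total_tmul X Y) ?_
  rintro _ ⟨p, q, rfl⟩
  -- Moving scalars across the tensor sign: (xb)⟨x', p⟩ ⊗ q = x ⊗ b⟨x', p⟩q = x ⊗ y⟨y', ⟨x', p⟩q⟩.
  rw [act_tmul, ha, inner_tmul, rmul_tmul, ← hb, tmul_rmul, tmul_rmul]

/-- By `IsRankOne.tensor`, the operator of x ⊗ y and x' ⊗ y' is implemented by L(xb, x'), where `b`
implements that of `y` and `y'`. Such `b` are total in B, so the vectors xb are total in `X` and the
elements L(xb, x') in A. -/
theorem IsImprimitivity.tensor (hX : X.IsImprimitivity) (hY : Y.IsImprimitivity) :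
    (X.tensor Y).IsImprimitivity := by
  have hX' := hX
  obtain ⟨hXf, L, hL⟩ := hX'
  obtain ⟨hYf, hYi, hYe, hYd⟩ := isImprimitivity_iff.mp hY
  refine isImprimitivity_iff.mpr ⟨Full.tensor hXf hYf hY.nondegenerate, hX.faithful.tensor hYi,
    exists_isRankOne_of_total (hX.faithful.tensor hYi) (total_tmul X Y) (total_tmul X Y) ?_, ?_⟩
  · rintro _ ⟨x, y, rfl⟩ _ ⟨x', y', rfl⟩
    obtain ⟨b, hb⟩ := hYe y y'
    exact ⟨_, hb.tensor (L.isRankOne _ _)⟩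
  · have htot : Dense (Submodule.span ℂ {w : X | ∃ x b, (∃ y y', Y.IsRankOne b y y') ∧
        X.rmul b x = w} : Set X) := by
      refine total_of_total (X.total_rmul (S := Set.univ) (by simp)) ?_
      rintro _ ⟨b, -, x, -, rfl⟩
      refine map_mem_closure_of_total hYd (X.rmul.flip x) (X.continuous_rmul_left x) ?_ b
      exact fun b hb => Submodule.le_topologicalClosure _ (Submodule.subset_span ⟨x, b, hb, rfl⟩)
    refine total_of_total hL ?_
    rintro _ ⟨x, x', rfl⟩
    refine map_mem_closure_of_total htot (L.toFun.flip x') (L.continuous_left hX.faithful x') ?_ x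
    rintro _ ⟨x, b, ⟨y, y', hb⟩, rfl⟩
    exact Submodule.le_topologicalClosure _ (Submodule.subset_span
      ⟨_, _, hb.tensor (L.isRankOne _ _)⟩)

/-- A full nondegenerate correspondence is an imprimitivity bimodule as soon as its tensor product
with some faithful correspondence is one. -/
theorem IsImprimitivity.of_tensor (hX : X.Full) (hX' : X.Nondegenerate) (hY : Y.Faithful)
    (h : (X.tensor Y).IsImprimitivity) : X.IsImprimitivity := by
  have hP := h.faithful
  obtain ⟨-, L, hL⟩ := h
  have hXi : X.Faithful := hP.of_tensor
  -- With a = L(p, y₀ ⊗ n₀), the element L(p, y ⊗ ⟨x, y₀⟩n₀) implements the rank-one operator of ax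
  -- and y. Both sides send z ⊗ n to p⟨n₀, ⟨y₀, x⟩⟨y, z⟩n⟩, and faithfulness of `Y` cancels `n`.
  have key : ∀ p y₀ n₀ x y, X.IsRankOne
      (L.toFun p (tmul X Y y (Y.act (X.inner x y₀) n₀))) (X.act (L.toFun p (tmul X Y y₀ n₀)) x) y := by
    intro p y₀ n₀ x y z
    rw [← sub_eq_zero]
    refine eq_zero_of_tmul_eq_zero hY fun n => ?_
    rw [map_sub, LinearMap.sub_apply, sub_eq_zero, tmul_rmul, ← act_tmul, ← act_tmul, L.act_toFun,
      L.act_toFun, inner_tmul, inner_tmul, Y.inner_act, X.star_inner]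
  have htot : Dense (Submodule.span ℂ {a : A | ∃ p y n, L.toFun p (tmul X Y y n) = a} : Set A) := by
    refine total_of_total hL ?_
    rintro _ ⟨p, q, rfl⟩
    refine map_mem_closure_of_total (total_tmul X Y) (L.toFun p) (L.continuous_right hP p) ?_ q
    rintro _ ⟨y, n, rfl⟩
    exact Submodule.le_topologicalClosure _ (Submodule.subset_span ⟨p, y, n, rfl⟩)
  refine isImprimitivity_iff.mpr ⟨hX, hXi, exists_isRankOne_of_total hXi (hX'.total_act htot)
    (T := Set.univ) (by simp) ?_, ?_⟩
  · rintro _ ⟨_, ⟨p, y₀, n₀, rfl⟩, x, rfl⟩ y -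
    exact ⟨_, key p y₀ n₀ x y⟩
  · refine total_of_total hL ?_
    rintro _ ⟨p, q, rfl⟩
    -- Since y⟨x, y₀⟩ ⊗ n₀ = y ⊗ ⟨x, y₀⟩n₀ and the vectors y⟨x, y₀⟩ are total, the elements found in
    -- `key` are already total in A.
    refine map_mem_closure_of_total
      (total_tmul_of_total hX.total_rmul_inner (T := (Set.univ : Set Y)) (by simp))
      (L.toFun p) (L.continuous_right hP p) ?_ q
    rintro _ ⟨_, ⟨y, x, y₀, rfl⟩, n₀, -, rfl⟩
    refine Submodule.le_topologicalClosure _ (Submodule.subset_span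
      ⟨X.act (L.toFun p (tmul X Y y₀ n₀)) x, y, ?_⟩)
    dsimp only
    rw [tmul_rmul]
    exact key p y₀ n₀ x y

end Tensor

end Correspondence

/-! ### The identity correspondence and the dual of an imprimitivity bimodule -/

/-- The complex conjugate of a normed space. -/
def ConjSpace (V : Type u) : Type u := V

namespace ConjSpace

variable (V : Type u) [NormedAddCommGroup V] [NormedSpace ℂ V]

instance : NormedAddCommGroup (ConjSpace V) := inferInstanceAs (NormedAddCommGroup V)

instance [CompleteSpace V] : CompleteSpace (ConjSpace V) := inferInstanceAs (CompleteSpace V)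

noncomputable instance : Module ℂ (ConjSpace V) := Module.compHom V (starRingEnd ℂ)

noncomputable instance : NormedSpace ℂ (ConjSpace V) where
  norm_smul_le c v := by
    rw [← RCLike.norm_conj c]
    exact norm_smul_le (starRingEnd ℂ c) (show V from v)

/-- The conjugate-linear identity map to the conjugate space. -/
noncomputable def conj : V ≃ₗ⋆[ℂ] ConjSpace V where
  toFun v := v
  invFun v := v
  map_add' _ _ := rfl
  map_smul' c v := show c • v = (starRingEnd ℂ (starRingEnd ℂ c)) • v by simp
  left_inv _ := rfl
  right_inv _ := rfl

variable {V}

theorem conj_smul (c : ℂ) (v : V) : conj V (c • v) = starRingEnd ℂ c • conj V v :=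
  (conj V).map_smulₛₗ c v

theorem conj_symm_smul (c : ℂ) (v : ConjSpace V) :
    (conj V).symm (c • v) = starRingEnd ℂ c • (conj V).symm v :=
  (conj V).symm.map_smulₛₗ c v

end ConjSpace

namespace Correspondence

variable {A B C D : Type u} [NonUnitalCStarAlgebra A] [PartialOrder A] [StarOrderedRing A]
  [NonUnitalCStarAlgebra B] [PartialOrder B] [StarOrderedRing B]
  [NonUnitalCStarAlgebra C] [PartialOrder C] [StarOrderedRing C]
  [NonUnitalCStarAlgebra D] [PartialOrder D] [StarOrderedRing D]

/-- The identity correspondence. -/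
noncomputable def identity (A : Type u) [NonUnitalCStarAlgebra A] [PartialOrder A]
    [StarOrderedRing A] : Correspondence A A where
  carrier := A
  rmul := (LinearMap.mul ℂ A).flip
  inner := (LinearMap.mul ℂ A).comp (starLinearEquiv ℂ : A ≃ₗ⋆[ℂ] A).toLinearMap
  act := LinearMap.mul ℂ A
  rmul_mul b c x := (mul_assoc x b c).symm
  inner_rmul x y b := (mul_assoc (star x) y b).symm
  star_inner x y := by simp
  inner_self_nonneg x := star_mul_self_nonneg x
  norm_sq_eq x := (sq _).trans CStarRing.norm_star_mul_self.symm
  act_mul a b x := mul_assoc a b x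
  inner_act a x y := by simp [mul_assoc]

theorem tensor_identity (X : Correspondence A B) :
    (X.tensor (identity B)).UnitarilyEquivalent X := by
  refine tensor_unitarilyEquivalent_of (fun x (b : B) => X.rmul b x) ?_
    (fun x (b : B) x' (b' : B) => ?_) (fun a x b => X.act_rmul a b x)
  · refine (X.total_rmul (S := Set.univ) (by simp)).mono (Submodule.span_mono ?_)
    rintro _ ⟨b, -, x, -, rfl⟩
    exact ⟨x, b, rfl⟩
  · change X.inner (X.rmul b x) (X.rmul b' x') = star b * (X.inner x x' * b')
    rw [X.inner_rmul, inner_rmul_left, mul_assoc]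

/-- The map a ⊗ x ↦ ax always preserves inner products; nondegeneracy is exactly the density of its
range. -/
theorem Nondegenerate.identity_tensor {X : Correspondence A B} (hX : X.Nondegenerate) :
    ((identity A).tensor X).UnitarilyEquivalent X := by
  refine tensor_unitarilyEquivalent_of (fun (a : A) x => X.act a x) hX
    (fun (a : A) x (a' : A) x' => ?_) (fun a a' x => (X.act_mul a a' x).symm)
  change X.inner (X.act a x) (X.act a' x') = X.inner x (X.act (star a * a') x')
  rw [X.inner_act, X.act_mul]

section Dual

variable {X : Correspondence A B}

/-- The dual of an imprimitivity bimodule: the conjugate space, with the two inner products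
exchanged. -/
noncomputable def LeftInner.dual (L : X.LeftInner) (h : X.Faithful) : Correspondence B A where
  carrier := ConjSpace X
  rmul := LinearMap.mk₂ ℂ
    (fun a v => ConjSpace.conj X (X.act (star a) ((ConjSpace.conj X).symm v)))
    (by intros; simp) (by intros; simp [ConjSpace.conj_smul])
    (by intros; simp) (by intros; simp [ConjSpace.conj_smul, ConjSpace.conj_symm_smul])
  inner := LinearMap.mk₂'ₛₗ (starRingEnd ℂ) (RingHom.id ℂ)
    (fun v w => L.toFun ((ConjSpace.conj X).symm v) ((ConjSpace.conj X).symm w))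
    (by intros; simp) (by intros; simp [ConjSpace.conj_symm_smul])
    (by intros; simp) (by intros; simp [ConjSpace.conj_symm_smul])
  act := LinearMap.mk₂ ℂ
    (fun b v => ConjSpace.conj X (X.rmul (star b) ((ConjSpace.conj X).symm v)))
    (by intros; simp) (by intros; simp [ConjSpace.conj_smul])
    (by intros; simp) (by intros; simp [ConjSpace.conj_smul, ConjSpace.conj_symm_smul])
  rmul_mul a b v := by simp [X.act_mul]
  inner_rmul v w a := by simp [L.toFun_act_right]
  star_inner v w := by simp [L.star_toFun]
  inner_self_nonneg v := L.self_nonneg _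
  norm_sq_eq v := (L.norm_toFun_self h _).symm
  act_mul a b v := by simp [X.rmul_mul]
  inner_act b v w := by simp [L.toFun_rmul_left h]

variable (L : X.LeftInner) (h : X.Faithful)

/-- The conjugate-linear bijection of a bimodule with its dual. -/
noncomputable def LeftInner.toDual : X ≃ₗ⋆[ℂ] L.dual h := ConjSpace.conj X

theorem LeftInner.inner_toDual (x y : X) :
    (L.dual h).inner (L.toDual h x) (L.toDual h y) = L.toFun x y := rfl

theorem LeftInner.act_toDual (b : B) (x : X) :
    (L.dual h).act b (L.toDual h x) = L.toDual h (X.rmul (star b) x) := rfl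

theorem LeftInner.rmul_toDual (a : A) (x : X) :
    (L.dual h).rmul a (L.toDual h x) = L.toDual h (X.act (star a) x) := rfl

/-- On the dual, ⟨x, y⟩ ∈ B implements the rank-one operator of the conjugates of `x` and `y`, so
the two fullness conditions on `X` change places. -/
theorem LeftInner.isImprimitivity_dual (hX : X.Full)
    (hL : Dense (Submodule.span ℂ {a : A | ∃ x y : X, L.toFun x y = a} : Set A)) :
    (L.dual h).IsImprimitivity := by
  have hr : ∀ x y, (L.dual h).IsRankOne (X.inner x y) (L.toDual h x) (L.toDual h y) := by
    intro x y z
    obtain ⟨z, rfl⟩ := (L.toDual h).surjective z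
    rw [act_toDual, inner_toDual, rmul_toDual, X.star_inner, L.star_toFun, L.act_toFun]
  refine isImprimitivity_iff.mpr ⟨hL.mono (Submodule.span_mono ?_), fun b hb => ?_,
    fun x y => ?_, hX.mono (Submodule.span_mono ?_)⟩
  · rintro _ ⟨x, y, rfl⟩
    exact ⟨L.toDual h x, L.toDual h y, rfl⟩
  · have h1 : ∀ c : B, c * star b = 0 := by
      refine eq_of_total (f := LinearMap.mulRight ℂ (star b)) (g := 0) hX
        (continuous_mul_const (star b)) continuous_zero ?_
      rintro _ ⟨x, y, rfl⟩
      change _ * star b = 0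
      have := hb (L.toDual h y)
      rw [act_toDual, LinearEquiv.map_eq_zero_iff] at this
      rw [← X.inner_rmul, this, map_zero]
    exact (CStarRing.mul_star_self_eq_zero_iff b).mp (h1 b)
  · obtain ⟨x, rfl⟩ := (L.toDual h).surjective x
    obtain ⟨y, rfl⟩ := (L.toDual h).surjective y
    exact ⟨_, hr x y⟩
  · rintro _ ⟨x, y, rfl⟩
    exact ⟨_, _, hr x y⟩

/-- The unitary sends x ⊗ ȳ to L(x, y), and left fullness makes its range dense. -/
theorem LeftInner.tensor_dual
    (hL : Dense (Submodule.span ℂ {a : A | ∃ x y : X, L.toFun x y = a} : Set A)) :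
    (X.tensor (L.dual h)).UnitarilyEquivalent (identity A) := by
  refine tensor_unitarilyEquivalent_of (Z := identity A)
    (fun x y => L.toFun x ((L.toDual h).symm y)) (hL.mono (Submodule.span_mono ?_))
    (fun x y x' y' => ?_) (fun a x y => (L.act_left a x _).symm)
  · rintro _ ⟨x, y, rfl⟩
    exact ⟨x, L.toDual h y, rfl⟩
  · obtain ⟨y, rfl⟩ := (L.toDual h).surjective y
    obtain ⟨y', rfl⟩ := (L.toDual h).surjective y'
    rw [act_toDual, inner_toDual, X.star_inner, ← L.act_toFun, L.toFun_act_right, L.star_toFun,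
      LinearEquiv.symm_apply_apply, LinearEquiv.symm_apply_apply]
    change star (L.toFun x y) * L.toFun x' y' = _
    rw [L.star_toFun]

/-- The unitary sends x̄ ⊗ y to ⟨x, y⟩, and right fullness makes its range dense. -/
theorem LeftInner.dual_tensor (hX : X.Full) :
    ((L.dual h).tensor X).UnitarilyEquivalent (identity B) := by
  refine tensor_unitarilyEquivalent_of (Z := identity B)
    (fun x y => X.inner ((L.toDual h).symm x) y) (hX.mono (Submodule.span_mono ?_))
    (fun x y x' y' => ?_) (fun b x y => ?_)
  · rintro _ ⟨x, y, rfl⟩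
    exact ⟨L.toDual h x, y, rfl⟩
  · obtain ⟨x, rfl⟩ := (L.toDual h).surjective x
    obtain ⟨x', rfl⟩ := (L.toDual h).surjective x'
    rw [inner_toDual, L.act_toFun, X.inner_rmul,
      LinearEquiv.symm_apply_apply, LinearEquiv.symm_apply_apply, ← X.star_inner x y]
    rfl
  · obtain ⟨x, rfl⟩ := (L.toDual h).surjective x
    rw [act_toDual, LinearEquiv.symm_apply_apply, LinearEquiv.symm_apply_apply, inner_rmul_left,
      star_star]
    rfl

end Dual

/-- Every imprimitivity bimodule has an inverse. -/
theorem IsImprimitivity.exists_inverse {M : Correspondence A B} (hM : M.IsImprimitivity) :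
    ∃ N : Correspondence B A, N.IsImprimitivity ∧
      (M.tensor N).UnitarilyEquivalent (identity A) ∧
      (N.tensor M).UnitarilyEquivalent (identity B) := by
  have h := hM.faithful
  obtain ⟨hf, L, hL⟩ := hM
  exact ⟨L.dual h, L.isImprimitivity_dual h hf hL, L.tensor_dual h hL, L.dual_tensor h hf⟩

end Correspondence

/-! ### Comparison of the relations -/

open Correspondence

section Relations

variable {A B : Type u} [NonUnitalCStarAlgebra A] [PartialOrder A] [StarOrderedRing A]
  [NonUnitalCStarAlgebra B] [PartialOrder B] [StarOrderedRing B]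
  {E : Correspondence A A} {F : Correspondence B B}

/-- Take R = E ⊗ M and S = M⁻¹. Then R ⊗ S ≈ E by cancelling M ⊗ M⁻¹, and S ⊗ R ≈ M⁻¹ ⊗ M ⊗ F ≈ F.
-/
theorem StrongMoritaEquivalent.elementaryStrongShiftEquivalent
    (h : StrongMoritaEquivalent E F) (hE : E.IsImprimitivity) (hF : F.IsImprimitivity) :
    ElementaryStrongShiftEquivalent imprimitivityBimodules E F := by
  obtain ⟨M, hM, hEF⟩ := h
  obtain ⟨N, hN, hMN, hNM⟩ := hM.exists_inverse
  refine ⟨E.tensor M, N, hE.tensor hM, hN, ?_, ?_⟩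
  · exact ((tensor_assoc E M N).trans ((tensor_congr_right E hMN).trans (tensor_identity E))).symm
  · exact ((tensor_congr_right N hEF).trans ((tensor_assoc N M F).symm.trans
      ((tensor_congr_left F hNM).trans hF.nondegenerate.identity_tensor))).symm

theorem ElementaryStrongShiftEquivalent.mono
    (h : ElementaryStrongShiftEquivalent imprimitivityBimodules E F) :
    ElementaryStrongShiftEquivalent allCorrespondences E F := by
  obtain ⟨R, S, -, -, h1, h2⟩ := h
  exact ⟨R, S, trivial, trivial, h1, h2⟩

theorem ShiftEquivalent.mono (h : ShiftEquivalent imprimitivityBimodules E F) :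
    ShiftEquivalent allCorrespondences E F := by
  obtain ⟨n, R, S, -, -, h⟩ := h
  exact ⟨n, R, S, trivial, trivial, h⟩

theorem StrongShiftEquivalent.mono (h : StrongShiftEquivalent imprimitivityBimodules E F) :
    StrongShiftEquivalent allCorrespondences E F := by
  induction h with
  | refl _ _ h => exact .refl trivial trivial h
  | step _ h _ ih => exact .step trivial h.mono ih

theorem ElementaryStrongShiftEquivalent.strongShiftEquivalent {𝒞 : CorrClass.{u}}
    (h : ElementaryStrongShiftEquivalent 𝒞 E F) (hE : 𝒞 E) (hF : 𝒞 F) :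
    StrongShiftEquivalent 𝒞 E F :=
  .step hE h (.refl hF hF (.refl F))

theorem ElementaryStrongShiftEquivalent.shiftEquivalent {𝒞 : CorrClass.{u}}
    (h : ElementaryStrongShiftEquivalent 𝒞 E F) : ShiftEquivalent 𝒞 E F := by
  obtain ⟨R, S, hR, hS, hE, hF⟩ := h
  -- Lag one; both intertwining relations are rebracketings: E ⊗ R ≈ R ⊗ S ⊗ R ≈ R ⊗ F, and likewise
  -- for `S`.
  exact ⟨0, R, S, hR, hS, hE, hF,
    (tensor_congr_left R hE).trans ((tensor_assoc R S R).trans (tensor_congr_right R hF.symm)),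
    (tensor_congr_right S hE).trans ((tensor_assoc S R S).symm.trans
      (tensor_congr_left S hF.symm))⟩

theorem tensorPowSucc_comm (E : Correspondence A A) (n : ℕ) :
    (E.tensor (E.tensorPowSucc n)).UnitarilyEquivalent ((E.tensorPowSucc n).tensor E) := by
  induction n with
  | zero => exact .refl _
  | succ n ih => exact (tensor_congr_right E ih).trans (tensor_assoc _ _ _).symm

theorem tensorPowSucc_intertwine {R : Correspondence A B}
    (h : (E.tensor R).UnitarilyEquivalent (R.tensor F)) (n : ℕ) :
    ((E.tensorPowSucc n).tensor R).UnitarilyEquivalent (R.tensor (F.tensorPowSucc n)) := by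
  induction n with
  | zero => exact h
  | succ n ih =>
    exact (tensor_assoc _ _ _).trans ((tensor_congr_right E ih).trans
      ((tensor_assoc _ _ _).symm.trans ((tensor_congr_left _ h).trans (tensor_assoc _ _ _))))

theorem Correspondence.IsImprimitivity.tensorPowSucc (hE : E.IsImprimitivity) (n : ℕ) :
    (E.tensorPowSucc n).IsImprimitivity := by
  induction n with
  | zero => exact hE
  | succ n ih => exact hE.tensor ih

theorem StrongShiftEquivalent.shiftEquivalent (h : StrongShiftEquivalent allCorrespondences E F) :
    ShiftEquivalent allCorrespondences E F := by
  induction h with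
  | @refl A _ _ _ E F _ _ h =>
    -- Lag two with R = S = E. Lag one with the identity correspondence as a factor would need `E`
    -- to be nondegenerate.
    exact ⟨1, E, E, trivial, trivial, .refl _, h.symm.tensor h.symm, tensor_congr_right E h,
      tensor_congr_left E h⟩
  | @step A _ _ _ D _ _ _ B _ _ _ E T F _ h _ ih =>
    obtain ⟨R, S, -, -, hE, hT⟩ := h
    obtain ⟨n, R', S', -, -, h1, h2, h3, h4⟩ := ih
    have hER : (E.tensor R).UnitarilyEquivalent (R.tensor T) :=
      (tensor_congr_left R hE).trans ((tensor_assoc R S R).trans (tensor_congr_right R hT.symm))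
    have hSE : (S.tensor E).UnitarilyEquivalent (T.tensor S) :=
      (tensor_congr_right S hE).trans ((tensor_assoc S R S).symm.trans
        (tensor_congr_left S hT.symm))
    -- Lags add: one for the elementary step and n + 1 for the rest of the chain, recorded as index
    -- n + 1.
    refine ⟨n + 1, R.tensor R', S'.tensor S, trivial, trivial, ?_, ?_, ?_, ?_⟩
    · calc (E.tensorPowSucc (n + 1)).UnitarilyEquivalent ((E.tensorPowSucc n).tensor E) :=
            tensorPowSucc_comm E n
        _ |>.UnitarilyEquivalent ((E.tensorPowSucc n).tensor (R.tensor S)) :=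
            tensor_congr_right _ hE
        _ |>.UnitarilyEquivalent (((E.tensorPowSucc n).tensor R).tensor S) :=
            (tensor_assoc _ _ _).symm
        _ |>.UnitarilyEquivalent ((R.tensor (T.tensorPowSucc n)).tensor S) :=
            tensor_congr_left S (tensorPowSucc_intertwine hER n)
        _ |>.UnitarilyEquivalent ((R.tensor (R'.tensor S')).tensor S) :=
            tensor_congr_left S (tensor_congr_right R h1)
        _ |>.UnitarilyEquivalent (((R.tensor R').tensor S').tensor S) :=
            tensor_congr_left S (tensor_assoc _ _ _).symm
        _ |>.UnitarilyEquivalent ((R.tensor R').tensor (S'.tensor S)) := tensor_assoc _ _ _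
    · calc (F.tensorPowSucc (n + 1)).UnitarilyEquivalent ((F.tensorPowSucc n).tensor F) :=
            tensorPowSucc_comm F n
        _ |>.UnitarilyEquivalent ((S'.tensor R').tensor F) := tensor_congr_left F h2
        _ |>.UnitarilyEquivalent (S'.tensor (R'.tensor F)) := tensor_assoc _ _ _
        _ |>.UnitarilyEquivalent (S'.tensor (T.tensor R')) := tensor_congr_right S' h3.symm
        _ |>.UnitarilyEquivalent (S'.tensor ((S.tensor R).tensor R')) :=
            tensor_congr_right S' (tensor_congr_left R' hT)
        _ |>.UnitarilyEquivalent (S'.tensor (S.tensor (R.tensor R'))) :=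
            tensor_congr_right S' (tensor_assoc _ _ _)
        _ |>.UnitarilyEquivalent ((S'.tensor S).tensor (R.tensor R')) := (tensor_assoc _ _ _).symm
    · calc (E.tensor (R.tensor R')).UnitarilyEquivalent ((E.tensor R).tensor R') :=
            (tensor_assoc _ _ _).symm
        _ |>.UnitarilyEquivalent ((R.tensor T).tensor R') := tensor_congr_left R' hER
        _ |>.UnitarilyEquivalent (R.tensor (T.tensor R')) := tensor_assoc _ _ _
        _ |>.UnitarilyEquivalent (R.tensor (R'.tensor F)) := tensor_congr_right R h3
        _ |>.UnitarilyEquivalent ((R.tensor R').tensor F) := (tensor_assoc _ _ _).symm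
    · calc ((S'.tensor S).tensor E).UnitarilyEquivalent (S'.tensor (S.tensor E)) :=
            tensor_assoc _ _ _
        _ |>.UnitarilyEquivalent (S'.tensor (T.tensor S)) := tensor_congr_right S' hSE
        _ |>.UnitarilyEquivalent ((S'.tensor T).tensor S) := (tensor_assoc _ _ _).symm
        _ |>.UnitarilyEquivalent ((F.tensor S').tensor S) := tensor_congr_left S h4
        _ |>.UnitarilyEquivalent (F.tensor (S'.tensor S)) := tensor_assoc _ _ _

/-- `R` itself may be degenerate; E ⊗ R is not, and still intertwines `E` and `F`. Here (E ⊗ R) ⊗ S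
≈ E^{⊗(n+2)}, while S ⊗ (E ⊗ R) ≈ F ⊗ S ⊗ R ≈ F^{⊗(n+2)} supplies fullness of E ⊗ R and faithfulness
of `S`. -/
theorem ShiftEquivalent.strongMoritaEquivalent (h : ShiftEquivalent allCorrespondences E F)
    (hE : E.IsImprimitivity) (hF : F.IsImprimitivity) : StrongMoritaEquivalent E F := by
  obtain ⟨n, R, S, -, -, h1, h2, h3, h4⟩ := h
  have hMS : ((E.tensor R).tensor S).IsImprimitivity :=
    ((tensor_congr_right E h1).trans (tensor_assoc E R S).symm).isImprimitivity
      (hE.tensor (hE.tensorPowSucc n))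
  have hSM : (S.tensor (E.tensor R)).IsImprimitivity :=
    ((tensor_congr_right F h2).trans ((tensor_assoc F S R).symm.trans
      ((tensor_congr_left R h4.symm).trans (tensor_assoc S E R)))).isImprimitivity
      (hF.tensor (hF.tensorPowSucc n))
  exact ⟨E.tensor R, .of_tensor hSM.full.of_tensor hE.nondegenerate.tensor hSM.faithful.of_tensor
    hMS, (tensor_congr_right E h3).trans (tensor_assoc E R F).symm⟩

end Relations

end CorrShift

/-! ### The equivalence of the seven conditions -/

theorem mainTheorem7 {A B : Type u}
    [NonUnitalCStarAlgebra A] [PartialOrder A] [StarOrderedRing A]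
    [NonUnitalCStarAlgebra B] [PartialOrder B] [StarOrderedRing B]
    (E : CorrShift.Correspondence A A) (F : CorrShift.Correspondence B B)
    (hE : E.IsImprimitivity) (hF : F.IsImprimitivity) :
    List.TFAE
      [CorrShift.StrongMoritaEquivalent E F,
        CorrShift.ElementaryStrongShiftEquivalent CorrShift.allCorrespondences E F,
        CorrShift.StrongShiftEquivalent CorrShift.allCorrespondences E F,
        CorrShift.ShiftEquivalent CorrShift.allCorrespondences E F,
        CorrShift.ElementaryStrongShiftEquivalent CorrShift.imprimitivityBimodules E F,
        CorrShift.StrongShiftEquivalent CorrShift.imprimitivityBimodules E F,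
        CorrShift.ShiftEquivalent CorrShift.imprimitivityBimodules E F] := by
  tfae_have 1 → 5 := fun h => h.elementaryStrongShiftEquivalent hE hF
  tfae_have 5 → 6 := fun h => h.strongShiftEquivalent hE hF
  tfae_have 5 → 7 := fun h => h.shiftEquivalent
  tfae_have 5 → 2 := fun h => h.mono
  tfae_have 2 → 3 := fun h => h.strongShiftEquivalent trivial trivial
  tfae_have 6 → 3 := fun h => h.mono
  tfae_have 3 → 4 := fun h => h.shiftEquivalent
  tfae_have 7 → 4 := fun h => h.mono
  tfae_have 4 → 1 := fun h => h.strongMoritaEquivalent hE hF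
  tfae_finish
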